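/- For a set partition $\pi$ of $[n]=\{1,\dots,n\}$, a circular edge of $\pi$ is a pair $(i,j)$ such that $i<j$ are consecutive elements of a block of $\pi$ (no element of that block lies strictly between them), or $i=\min B$ and $j=\max B$ for some block $B$ of $\pi$. A circular crossing of $\pi$ is a sequence $(i_1,j_1),(i_2,j_2)$ of two circular edges of $\pi$ with $i_1<i_2<j_1<j_2$. Let $B_n$ be the Bell numbers and $S_{n,k}$ the Stirling numbers of the second kind, taken to be $0$ when an index is negative. The average number $\mu_n$ of circular crossings in a uniformly random set partition of $[n]$ satisfies, for all $n\ge 0$, $$\mu_n=\frac n2\,\frac{B_{n+1}}{B_n}+\frac{3n}2-\frac{n(4n+1)}2\,\frac{B_{n-1}}{B_n}-2\binom n2\frac{B_{n-2}}{B_n}+\binom n4\frac{B_{n-4}}{B_n},$$ and $$\mu_n=\frac{n^2}{2\log n}\left(1+\frac{\log\log n}{\log n}\,(1+o(1))\right)\qquad\text{as } n\to\infty.$$ The average number $\mu_{n,k}$ of circular crossings in a uniformly random set partition of $[n]$ into $k$ blocks satisfies, for all $n\ge k\ge 1$, $$\mu_{n,k}=\frac12 n(k-1)-\frac12 n(4n-5k+1)\frac{S_{n-1,k-1}}{S_{n,k}}-2\binom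 n2\frac{S_{n-2,k-2}}{S_{n,k}}+\binom n4\frac{S_{n-4,k-2}}{S_{n,k}},$$ and, for each fixed $k\ge 1$, $$\mu_{n,k}=\frac12 n(k-1)+o(1)\qquad\text{as } n\to\infty.$$ -/

import Mathlib

open Finset Filter Topology

/-- The circular edges contributed by one block `B`: the pairs `(i, j)` of elements of `B` such that
either `i < j` are consecutive in `B`, or `i = min B` and `j = max B`. -/
def blockCircularEdges (B : Finset ℕ) : Finset (ℕ × ℕ) :=
  {e ∈ B ×ˢ B |
    (e.1 < e.2 ∧ ∀ p ∈ B, ¬ (e.1 < p ∧ p < e.2)) ∨ ((∀ p ∈ B, e.1 ≤ p) ∧ (∀ p ∈ B, p ≤ e.2))}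

/-- The set of circular edges of a set partition. -/
def circularEdges {s : Finset ℕ} (P : Finpartition s) : Finset (ℕ × ℕ) :=
  P.parts.biUnion blockCircularEdges

/-- The circular crossings of a set partition: the pairs `((i₁, j₁), (i₂, j₂))` of circular edges
such that `i₁ < i₂ < j₁ < j₂`. -/
def circularCrossings {s : Finset ℕ} (P : Finpartition s) : Finset ((ℕ × ℕ) × (ℕ × ℕ)) :=
  {c ∈ circularEdges P ×ˢ circularEdges P |
    c.1.1 < c.2.1 ∧ c.2.1 < c.1.2 ∧ c.1.2 < c.2.2}

/-- The number of circular crossings of a set partition. -/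
def cro {s : Finset ℕ} (P : Finpartition s) : ℕ := #(circularCrossings P)

/-- The average number of circular crossings over all set partitions of `{1, …, n}`. -/
noncomputable def meanCro (n : ℕ) : ℝ :=
  (∑ P : Finpartition (Icc 1 n), (cro P : ℝ)) / (Fintype.card (Finpartition (Icc 1 n)) : ℝ)

/-- The average number of circular crossings over all set partitions of `{1, …, n}` into exactly
`k` blocks. -/
noncomputable def meanCroBlocks (n k : ℕ) : ℝ :=
  (∑ P : Finpartition (Icc 1 n) with #P.parts = k, (cro P : ℝ)) /
    (#{P : Finpartition (Icc 1 n) | #P.parts = k} : ℝ)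

/-- The Bell number `B_m`, equal to `0` for a negative index. -/
def bellB (m : ℤ) : ℕ := if 0 ≤ m then Nat.bell m.toNat else 0

/-- The Stirling number of the second kind `S_{m, l}`, equal to `0` if an index is negative. -/
def stirlingS (m l : ℤ) : ℕ :=
  if 0 ≤ m ∧ 0 ≤ l then Nat.stirlingSecond m.toNat l.toNat else 0

/-! Exact formulas. A colouring of `[n]` with `q` colours is the same as a set partition with an
injective colouring of its blocks, so summing crossings over all colourings gives `∑ k, (q)_k * T
k`, where `T k` is the total over partitions into `k` blocks (`sum_coloring_eq_sum_range`).
Colourings can be counted point by point. For fixed `a < b < c < d`, the pairs `(a, c)` and `(b, d)`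
are both edges when the colour of each pair is absent either strictly inside or strictly outside it.
Inclusion-exclusion on "inside or outside" for both pairs gives nine terms, each `q * (q - 1)` times
a product of one weight in `{q, q - 1, q - 2}` per point of the five gaps. Summing over the
positions gives generating functions `x ^ 4 / ∏ (1 - w_i x)`, and partial fractions collapse the
nine terms (`fourGaps_inclusion_exclusion`). Comparing coefficients in the falling factorial basis
identifies `T k` with the Stirling expression `totalCro`; summing over `k` gives the Bell version.

Asymptotics. Put `m = B_{n+1} / B_n`. Dobinski's formula makes `m` a mean for the weights `q ^ n /
q!`, and Jensen's inequality gives `(1 + 1/m) ^ n ≤ m` and `m * (1 - 1/m) ^ n ≤ 1`. Hence `(m - 1)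
log m ≤ n ≤ (m + 1) log m`, sharp enough for the second-order growth of `m`
(`tendsto_bellRatio_log`). The term `n * m / 2` dominates the mean; the others are `O(n ^ (4/3))`.
For fixed `k`, every correction contains a ratio of Stirling numbers that decays geometrically. -/

/-! ### Gap sums and partial fractions. -/

/-- Convolution of a sequence with the shifted geometric sequence of ratio `w`: in terms of
generating functions, multiplication by `x / (1 - w x)`. -/
noncomputable def gapSum (w : ℝ) : (ℕ → ℝ) →ₗ[ℝ] (ℕ → ℝ) where
  toFun X n := ∑ d ∈ range n, w ^ (n - 1 - d) * X d
  map_add' X Y := by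
    funext n
    simp [mul_add, sum_add_distrib]
  map_smul' c X := by
    funext n
    simp only [Pi.smul_apply, smul_eq_mul, RingHom.id_apply, mul_sum]
    exact sum_congr rfl fun _ _ => by ring

theorem gapSum_apply (w : ℝ) (X : ℕ → ℝ) (n : ℕ) :
    gapSum w X n = ∑ d ∈ range n, w ^ (n - 1 - d) * X d := rfl

theorem gapSum_zero (w : ℝ) (X : ℕ → ℝ) : gapSum w X 0 = 0 := by
  simp [gapSum_apply]

theorem gapSum_succ (w : ℝ) (X : ℕ → ℝ) (n : ℕ) :
    gapSum w X (n + 1) = w * gapSum w X n + X n := by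
  rw [gapSum_apply, gapSum_apply, sum_range_succ, mul_sum]
  congr 1
  · refine sum_congr rfl fun d hd => ?_
    rw [mem_range] at hd
    rw [← mul_assoc, ← pow_succ', show n + 1 - 1 - d = n - 1 - d + 1 by omega]
  · simp

theorem eq_gapSum {w : ℝ} {X Y : ℕ → ℝ} (h0 : Y 0 = 0)
    (hs : ∀ n, Y (n + 1) = w * Y n + X n) : gapSum w X = Y := by
  funext n
  induction n with
  | zero => rw [gapSum_zero, h0]
  | succ n ih => rw [gapSum_succ, hs, ih]

/-- The sequence `n ↦ (n choose j) w ^ (n - j)`, with generating function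
`x ^ j / (1 - w x) ^ (j + 1)`. -/
noncomputable def choosePow (w : ℝ) (j n : ℕ) : ℝ := (n.choose j : ℝ) * w ^ (n - j)

theorem choosePow_zero_right (w : ℝ) (j : ℕ) : choosePow w (j + 1) 0 = 0 := by
  simp [choosePow]

theorem choosePow_succ (w : ℝ) (j n : ℕ) :
    choosePow w (j + 1) (n + 1) = w * choosePow w (j + 1) n + choosePow w j n := by
  simp only [choosePow]
  rcases Nat.lt_or_ge n (j + 1) with h | h
  · rw [Nat.choose_succ_succ, Nat.choose_eq_zero_of_lt h]
    simp
  · obtain ⟨m, rfl⟩ := Nat.exists_eq_add_of_le h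
    rw [Nat.choose_succ_succ, show j + 1 + m + 1 - (j + 1) = m + 1 by omega,
      show j + 1 + m - (j + 1) = m by omega, show j + 1 + m - j = m + 1 by omega]
    push_cast
    ring

theorem gapSum_choosePow_self (w : ℝ) (j : ℕ) :
    gapSum w (choosePow w j) = choosePow w (j + 1) :=
  eq_gapSum (choosePow_zero_right w j) (choosePow_succ w j)

/-- Partial fractions: `x / ((1 - v x) (1 - w x)) = (1 / (w - v)) * (1 / (1 - w x) - 1 / (1 - v
x))`. The difference is a separate variable `c` so that numerals such as `2` or `-1` can replace it.
-/
theorem gapSum_choosePow_zero (v w c : ℝ) (hc : c ≠ 0) (h : w - v = c) :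
    gapSum v (choosePow w 0) = c⁻¹ • (choosePow w 0 - choosePow v 0) := by
  refine eq_gapSum (by simp [choosePow]) fun n => ?_
  have : w = v + c := by linarith
  subst this
  simp only [choosePow, Pi.smul_apply, Pi.sub_apply, smul_eq_mul]
  field_simp
  simp
  ring

/-- The same partial fraction step at a higher-order pole: it lowers the pole order at `w` by one,
so iterating it ends at `gapSum_choosePow_zero`. -/
theorem gapSum_choosePow_succ (v w c : ℝ) (hc : c ≠ 0) (h : w - v = c) (j : ℕ) :
    gapSum v (choosePow w (j + 1)) =
      c⁻¹ • (choosePow w (j + 1) - gapSum v (choosePow w j)) := by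
  refine eq_gapSum (by simp [choosePow_zero_right, gapSum_zero]) fun n => ?_
  have : w = v + c := by linarith
  subst this
  simp only [Pi.smul_apply, Pi.sub_apply, smul_eq_mul, gapSum_succ, choosePow_succ]
  field_simp
  ring

/-- The weighted sum over four marked points, `w₀, w₁, w₂, w₃, w₄` being the weights of the unmarked
points in the successive gaps. -/
noncomputable def fourGaps (w₀ w₁ w₂ w₃ w₄ : ℝ) : ℕ → ℝ :=
  gapSum w₄ (gapSum w₃ (gapSum w₂ (gapSum w₁ (choosePow w₀ 0))))

theorem fourGaps_apply (w₀ w₁ w₂ w₃ w₄ : ℝ) (n : ℕ) :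
    fourGaps w₀ w₁ w₂ w₃ w₄ n =
      ∑ d ∈ range n, ∑ c ∈ range d, ∑ b ∈ range c, ∑ a ∈ range b,
        w₀ ^ a * w₁ ^ (b - 1 - a) * w₂ ^ (c - 1 - b) * w₃ ^ (d - 1 - c) * w₄ ^ (n - 1 - d) := by
  simp only [fourGaps, gapSum_apply, mul_sum]
  refine sum_congr rfl fun d _ => sum_congr rfl fun c _ => sum_congr rfl fun b _ =>
    sum_congr rfl fun a _ => ?_
  simp only [choosePow, Nat.choose_zero_right, Nat.cast_one, Nat.sub_zero]
  ring

/-- The nine sign and weight patterns are those produced by `sum_colorEdge_colorEdge`. Each side is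
a combination of poles at `q`, `q - 1`, `q - 2`, so the identity is checked after complete partial
fraction expansion. -/
theorem fourGaps_inclusion_exclusion (q : ℝ) :
    fourGaps q (q - 1) (q - 2) (q - 1) q + fourGaps (q - 1) (q - 2) (q - 1) q (q - 1)
      + fourGaps (q - 1) q (q - 1) (q - 2) (q - 1)
      + fourGaps (q - 2) (q - 1) q (q - 1) (q - 2)
      - fourGaps (q - 1) (q - 1) (q - 2) (q - 2) (q - 1)
      - fourGaps (q - 2) (q - 2) (q - 1) (q - 1) (q - 2)
      - fourGaps (q - 1) (q - 2) (q - 2) (q - 1) (q - 1)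
      - fourGaps (q - 2) (q - 1) (q - 1) (q - 2) (q - 2)
      + fourGaps (q - 2) (q - 2) (q - 2) (q - 2) (q - 2) =
    (1 / 2 : ℝ) • choosePow q 1 + (2 : ℝ) • choosePow (q - 1) 1 - (4 : ℝ) • choosePow (q - 1) 2
      - (5 / 2 : ℝ) • choosePow (q - 2) 1 - (2 : ℝ) • choosePow (q - 2) 2
      + choosePow (q - 2) 4 := by
  have hqp0 := gapSum_choosePow_zero (q - 1) q 1 (by norm_num) (by ring)
  have hqr0 := gapSum_choosePow_zero (q - 2) q 2 (by norm_num) (by ring)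
  have hpq0 := gapSum_choosePow_zero q (q - 1) (-1) (by norm_num) (by ring)
  have hpr0 := gapSum_choosePow_zero (q - 2) (q - 1) 1 (by norm_num) (by ring)
  have hrq0 := gapSum_choosePow_zero q (q - 2) (-2) (by norm_num) (by ring)
  have hrp0 := gapSum_choosePow_zero (q - 1) (q - 2) (-1) (by norm_num) (by ring)
  have hqp := gapSum_choosePow_succ (q - 1) q 1 (by norm_num) (by ring)
  have hqr := gapSum_choosePow_succ (q - 2) q 2 (by norm_num) (by ring)
  have hpq := gapSum_choosePow_succ q (q - 1) (-1) (by norm_num) (by ring)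
  have hpr := gapSum_choosePow_succ (q - 2) (q - 1) 1 (by norm_num) (by ring)
  have hrq := gapSum_choosePow_succ q (q - 2) (-2) (by norm_num) (by ring)
  have hrp := gapSum_choosePow_succ (q - 1) (q - 2) (-1) (by norm_num) (by ring)
  have hqp1 := hqp 0
  have hqr1 := hqr 0
  have hpq1 := hpq 0
  have hpr1 := hpr 0
  have hrq1 := hrq 0
  have hrp1 := hrp 0
  have hqp2 := hqp 1
  have hqr2 := hqr 1
  have hpq2 := hpq 1
  have hpr2 := hpr 1
  have hrq2 := hrq 1
  have hrp2 := hrp 1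
  clear hqp hqr hpq hpr hrq hrp
  simp only [zero_add, Nat.reduceAdd] at *
  simp only [fourGaps, map_sub, map_smul, gapSum_choosePow_self, Nat.reduceAdd, zero_add, *]
  module

/-! ### Counting colourings in which two given pairs are edges. -/

/-- The points strictly inside (if `u`) and strictly outside (if `v`) the interval `[i, j]`. -/
def InsideOutside (u v : Bool) (i j x : ℕ) : Prop :=
  (u = true ∧ i < x ∧ x < j) ∨ (v = true ∧ (x < i ∨ j < x))

instance (u v : Bool) (i j x : ℕ) : Decidable (InsideOutside u v i j x) := by
  unfold InsideOutside; infer_instance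

/-- The points `i` and `j` have the same colour, which does not occur in `InsideOutside u v i j`. -/
def ClearPair {n q : ℕ} (u v : Bool) (f : Fin n → Fin q) (i j : Fin n) : Prop :=
  f i = f j ∧ ∀ x : Fin n, InsideOutside u v i j x → f x ≠ f i

instance {n q : ℕ} (u v : Bool) (f : Fin n → Fin q) (i j : Fin n) :
    Decidable (ClearPair u v f i j) := by
  unfold ClearPair; infer_instance

/-- The circular edges of a colouring are those of the partition into colour classes. -/
def ColorEdge {n q : ℕ} (f : Fin n → Fin q) (i j : Fin n) : Prop :=
  ClearPair true false f i j ∨ ClearPair false true f i j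

instance {n q : ℕ} (f : Fin n → Fin q) (i j : Fin n) : Decidable (ColorEdge f i j) := by
  unfold ColorEdge; infer_instance

theorem clearPair_true_true {n q : ℕ} (f : Fin n → Fin q) (i j : Fin n) :
    ClearPair true true f i j ↔ ClearPair true false f i j ∧ ClearPair false true f i j := by
  simp only [ClearPair, InsideOutside]
  constructor
  · rintro ⟨h, h'⟩
    exact ⟨⟨h, fun x hx => h' x (by simp at hx ⊢; tauto)⟩,
      ⟨h, fun x hx => h' x (by simp at hx ⊢; tauto)⟩⟩
  · rintro ⟨⟨h, h1⟩, ⟨_, h2⟩⟩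
    refine ⟨h, fun x hx => ?_⟩
    rcases hx with hx | hx
    · exact h1 x (Or.inl hx)
    · exact h2 x (Or.inr hx)

/-- Inclusion-exclusion: inside and outside clearance can both hold, namely when the colour class is
just `{i, j}`. -/
theorem indicator_colorEdge {n q : ℕ} (f : Fin n → Fin q) (i j : Fin n) :
    (if ColorEdge f i j then (1 : ℝ) else 0) =
      (if ClearPair true false f i j then 1 else 0) + (if ClearPair false true f i j then 1 else 0)
        - (if ClearPair true true f i j then 1 else 0) := by
  simp only [clearPair_true_true, ColorEdge]
  by_cases h1 : ClearPair true false f i j <;> by_cases h2 : ClearPair false true f i j <;>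
    simp [h1, h2]

theorem prod_range_eq_mul_pow {m k : ℕ} (hmk : m < k) {G : ℕ → ℝ} {w : ℝ} (h1 : G m = 1)
    (hw : ∀ x, m < x → x < k → G x = w) :
    ∏ x ∈ range k, G x = (∏ x ∈ range m, G x) * w ^ (k - 1 - m) := by
  rw [← prod_range_mul_prod_Ico G (show m + 1 ≤ k by omega), prod_range_succ, h1, mul_one]
  congr 1
  rw [prod_congr rfl (g := fun _ => w), prod_const, Nat.card_Ico]
  · congr 1; omega
  · intro x hx
    rw [mem_Ico] at hx
    exact hw x (by omega) hx.2

theorem prod_range_four_gaps {a b c d n : ℕ} (hab : a < b) (hbc : b < c) (hcd : c < d) (hdn : d < n)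
    {G : ℕ → ℝ} {w₀ w₁ w₂ w₃ w₄ : ℝ} (ha : G a = 1) (hb : G b = 1) (hc : G c = 1) (hd : G d = 1)
    (h0 : ∀ x, x < a → G x = w₀) (h1 : ∀ x, a < x → x < b → G x = w₁)
    (h2 : ∀ x, b < x → x < c → G x = w₂) (h3 : ∀ x, c < x → x < d → G x = w₃)
    (h4 : ∀ x, d < x → x < n → G x = w₄) :
    ∏ x ∈ range n, G x =
      w₀ ^ a * w₁ ^ (b - 1 - a) * w₂ ^ (c - 1 - b) * w₃ ^ (d - 1 - c) * w₄ ^ (n - 1 - d) := by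
  rw [prod_range_eq_mul_pow hdn hd h4, prod_range_eq_mul_pow hcd hc h3,
    prod_range_eq_mul_pow hbc hb h2, prod_range_eq_mul_pow hab ha h1,
    prod_congr rfl (g := fun _ => w₀), prod_const, card_range]
  intro x hx
  exact h0 x (mem_range.mp hx)

theorem card_filter_avoid {q : ℕ} {s t : Fin q} (hst : s ≠ t) (P Q : Prop) [Decidable P]
    [Decidable Q] :
    ((#{k : Fin q | (P → k ≠ s) ∧ (Q → k ≠ t)} : ℕ) : ℝ) =
      (q : ℝ) - (if P then 1 else 0) - (if Q then 1 else 0) := by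
  have key : ({k : Fin q | (P → k ≠ s) ∧ (Q → k ≠ t)} : Finset (Fin q)) =
      univ \ ((if P then {s} else ∅) ∪ (if Q then {t} else ∅)) := by
    ext k
    by_cases hP : P <;> by_cases hQ : Q <;> simp [hP, hQ]
  rw [key, card_sdiff_of_subset (subset_univ _), card_univ, Fintype.card_fin,
    Nat.cast_sub (by simpa using card_le_univ ((if P then {s} else ∅) ∪ (if Q then {t} else ∅)))]
  by_cases hP : P <;> by_cases hQ : Q <;> simp [hP, hQ, hst]
  ring

/-- The colours allowed at the point `x` when `a`, `c` have colour `s` and `b`, `d` have colour `t`,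
and these colours are avoided as prescribed by `u v` and `u' v'`. -/
def allowedColors {q : ℕ} (u v u' v' : Bool) (a b c d : ℕ) (s t : Fin q) (x : ℕ) :
    Finset (Fin q) :=
  if x = a ∨ x = c then {s} else if x = b ∨ x = d then {t} else
    univ.filter fun k => (InsideOutside u v a c x → k ≠ s) ∧ (InsideOutside u' v' b d x → k ≠ t)

/-- Each gap loses one colour per active avoidance condition. The successive gaps are outside both
pairs, inside the first only, inside both, inside the second only, and outside both again; `s ≠ t`
makes the two losses independent. -/
theorem card_allowedColors_prod {n q : ℕ} (u v u' v' : Bool) {a b c d : ℕ} (hab : a < b)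
    (hbc : b < c) (hcd : c < d) (hdn : d < n) {s t : Fin q} (hst : s ≠ t) (i o i' o' : ℝ)
    (hi : i = if u then 1 else 0) (ho : o = if v then 1 else 0)
    (hi' : i' = if u' then 1 else 0) (ho' : o' = if v' then 1 else 0) :
    ∏ x ∈ range n, (#(allowedColors u v u' v' a b c d s t x) : ℝ) =
      (q - o - o') ^ a * (q - i - o') ^ (b - 1 - a) * (q - i - i') ^ (c - 1 - b) *
        (q - o - i') ^ (d - 1 - c) * (q - o - o') ^ (n - 1 - d) := by
  have gen : ∀ x, x ≠ a → x ≠ b → x ≠ c → x ≠ d →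
      (#(allowedColors u v u' v' a b c d s t x) : ℝ) =
        q - (if InsideOutside u v a c x then 1 else 0)
          - (if InsideOutside u' v' b d x then 1 else 0) := by
    intro x h1 h2 h3 h4
    rw [allowedColors, if_neg (by tauto), if_neg (by tauto), card_filter_avoid hst]
  subst hi ho hi' ho'
  apply prod_range_four_gaps hab hbc hcd hdn
  · simp [allowedColors]
  · simp [allowedColors, hab.ne', hbc.ne]
  · simp [allowedColors]
  · simp [allowedColors, hcd.ne', (hab.trans (hbc.trans hcd)).ne']
  all_goals
    intro x
    intros
    rw [gen x (by omega) (by omega) (by omega) (by omega)]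
    congr 2
    · congr 1
      simp only [InsideOutside, eq_iff_iff]
      constructor
      · rintro (h | h)
        · first | exact h.1 | omega
        · first | exact h.1 | omega
      · intro h
        first | exact Or.inl ⟨h, by omega, by omega⟩ | exact Or.inr ⟨h, by omega⟩
    · simp only [InsideOutside, eq_iff_iff]
      constructor
      · rintro (h | h)
        · first | exact h.1 | omega
        · first | exact h.1 | omega
      · intro h
        first | exact Or.inl ⟨h, by omega, by omega⟩ | exact Or.inr ⟨h, by omega⟩

/-- Once the colours `s` of `a, c` and `t` of `b, d` are fixed, the remaining points are coloured
independently. The factor `q * (q - 1)` counts the ordered pairs `s ≠ t`. -/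
theorem card_clearPair_clearPair {n q : ℕ} (u v u' v' : Bool) (huv : u = true ∨ v = true)
    {a b c d : Fin n} (hab : a < b) (hbc : b < c) (hcd : c < d) (i o i' o' : ℝ)
    (hi : i = if u then 1 else 0) (ho : o = if v then 1 else 0)
    (hi' : i' = if u' then 1 else 0) (ho' : o' = if v' then 1 else 0) :
    (#{f : Fin n → Fin q | ClearPair u v f a c ∧ ClearPair u' v' f b d} : ℝ) =
      q * (q - 1) * ((q - o - o') ^ (a : ℕ) * (q - i - o') ^ (b - 1 - a : ℕ) *
        (q - i - i') ^ (c - 1 - b : ℕ) * (q - o - i') ^ (d - 1 - c : ℕ) *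
        (q - o - o') ^ (n - 1 - d : ℕ)) := by
  rw [card_eq_sum_card_fiberwise (f := fun f => (f a, f b)) (t := univ.offDiag)]
  · push_cast
    rw [sum_congr rfl (g := fun _ => (q - o - o') ^ (a : ℕ) * (q - i - o') ^ (b - 1 - a : ℕ) *
        (q - i - i') ^ (c - 1 - b : ℕ) * (q - o - i') ^ (d - 1 - c : ℕ) *
        (q - o - o') ^ (n - 1 - d : ℕ)), sum_const, nsmul_eq_mul, offDiag_card, card_univ,
        Fintype.card_fin]
    · congr 1
      rw [Nat.cast_sub (Nat.le_mul_self q)]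
      push_cast; ring
    · rintro ⟨s, t⟩ hst
      have hst : s ≠ t := by simpa using hst
      rw [← card_allowedColors_prod u v u' v' (Fin.lt_def.mp hab) (Fin.lt_def.mp hbc)
        (Fin.lt_def.mp hcd) d.2 hst i o i' o' hi ho hi' ho',
        ← Fin.prod_univ_eq_prod_range
          (fun x => (#(allowedColors u v u' v' a b c d s t x) : ℝ)) n]
      rw [← Nat.cast_prod, ← Fintype.card_piFinset]
      congr 2
      ext f
      simp only [mem_filter, mem_univ, true_and, Prod.mk.injEq, Fintype.mem_piFinset]
      constructor
      · rintro ⟨⟨⟨hac, h⟩, ⟨hbd, h'⟩⟩, rfl, rfl⟩ x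
        unfold allowedColors
        split_ifs with h1 h2
        · rcases h1 with h1 | h1 <;> rw [Fin.val_inj] at h1 <;> simp [h1, hac]
        · rcases h2 with h1 | h1 <;> rw [Fin.val_inj] at h1 <;> simp [h1, hbd]
        · simpa using ⟨h x, h' x⟩
      · intro h
        have ha : f a = s := by simpa [allowedColors] using h a
        have hc : f c = s := by simpa [allowedColors] using h c
        have hb : f b = t := by
          simpa [allowedColors, Fin.val_inj, hab.ne', hbc.ne] using h b
        have hd : f d = t := by
          simpa [allowedColors, Fin.val_inj, hcd.ne', (hab.trans (hbc.trans hcd)).ne'] using h d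
        refine ⟨⟨⟨ha.trans hc.symm, fun x hx => ?_⟩, ⟨hb.trans hd.symm, fun x hx => ?_⟩⟩, ha, hb⟩
        · rw [ha]
          have hx' := h x
          unfold allowedColors at hx'
          split_ifs at hx' with h1 h2
          · simp only [InsideOutside] at hx
            rw [Fin.lt_def] at *
            omega
          · rw [mem_singleton.mp hx']; exact hst.symm
          · simp only [mem_filter] at hx'
            exact hx'.2.1 hx
        · rw [hb]
          have hx' := h x
          unfold allowedColors at hx'
          split_ifs at hx' with h1 h2
          · rw [mem_singleton.mp hx']; exact hst
          · simp only [InsideOutside] at hx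
            rw [Fin.lt_def] at *
            omega
          · simp only [mem_filter] at hx'
            exact hx'.2.2 hx
  · intro f hf
    simp only [coe_filter, mem_univ, true_and, Set.mem_ofPred_eq] at hf
    obtain ⟨⟨hac, h⟩, ⟨hbd, h'⟩⟩ := hf
    simp only [coe_offDiag, Set.mem_offDiag, coe_univ, Set.mem_univ, true_and]
    intro he
    -- Crossing forces distinct colours: `b` lies inside `[a, c]` and `d` outside it, so either
    -- clearance of the first pair separates them.
    rcases huv with rfl | rfl
    · exact h b (Or.inl ⟨rfl, hab, hbc⟩) he.symm
    · exact h d (Or.inr ⟨rfl, Or.inr hcd⟩) (hbd.symm.trans he.symm)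

theorem sum_colorEdge_colorEdge {n : ℕ} (q : ℕ) {a b c d : Fin n} (hab : a < b) (hbc : b < c)
    (hcd : c < d) (W : ℝ → ℝ → ℝ → ℝ → ℝ)
    (hW : ∀ w₀ w₁ w₂ w₃, W w₀ w₁ w₂ w₃ = w₀ ^ (a : ℕ) * w₁ ^ (b - 1 - a : ℕ) *
        w₂ ^ (c - 1 - b : ℕ) * w₃ ^ (d - 1 - c : ℕ) * w₀ ^ (n - 1 - d : ℕ)) :
    (#{f : Fin n → Fin q | ColorEdge f a c ∧ ColorEdge f b d} : ℝ) =
      q * (q - 1) * (W q (q - 1) (q - 2) (q - 1) + W (q - 1) (q - 2) (q - 1) q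
        + W (q - 1) q (q - 1) (q - 2) + W (q - 2) (q - 1) q (q - 1)
        - W (q - 1) (q - 1) (q - 2) (q - 2) - W (q - 2) (q - 2) (q - 1) (q - 1)
        - W (q - 1) (q - 2) (q - 2) (q - 1) - W (q - 2) (q - 1) (q - 1) (q - 2)
        + W (q - 2) (q - 2) (q - 2) (q - 2)) := by
  have key : ∀ (u v u' v' : Bool) (_ : u = true ∨ v = true) (i o i' o' : ℝ)
      (_ : i = if u then 1 else 0) (_ : o = if v then 1 else 0)
      (_ : i' = if u' then 1 else 0) (_ : o' = if v' then 1 else 0),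
      (#{f : Fin n → Fin q | ClearPair u v f a c ∧ ClearPair u' v' f b d} : ℝ) =
        q * (q - 1) * W (q - o - o') (q - i - o') (q - i - i') (q - o - i') := by
    intro u v u' v' huv i o i' o' hi ho hi' ho'
    rw [hW]
    exact card_clearPair_clearPair u v u' v' huv hab hbc hcd i o i' o' hi ho hi' ho'
  have k1 := key true false true false (by simp) 1 0 1 0 (by simp) (by simp) (by simp) (by simp)
  have k2 := key true false false true (by simp) 1 0 0 1 (by simp) (by simp) (by simp) (by simp)
  have k3 := key false true true false (by simp) 0 1 1 0 (by simp) (by simp) (by simp) (by simp)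
  have k4 := key false true false true (by simp) 0 1 0 1 (by simp) (by simp) (by simp) (by simp)
  have k5 := key true true true false (by simp) 1 1 1 0 (by simp) (by simp) (by simp) (by simp)
  have k6 := key true true false true (by simp) 1 1 0 1 (by simp) (by simp) (by simp) (by simp)
  have k7 := key true false true true (by simp) 1 0 1 1 (by simp) (by simp) (by simp) (by simp)
  have k8 := key false true true true (by simp) 0 1 1 1 (by simp) (by simp) (by simp) (by simp)
  have k9 := key true true true true (by simp) 1 1 1 1 (by simp) (by simp) (by simp) (by simp)
  simp only [sub_zero, sub_sub, one_add_one_eq_two] at k1 k2 k3 k4 k5 k6 k7 k8 k9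
  have expand : (#{f : Fin n → Fin q | ColorEdge f a c ∧ ColorEdge f b d} : ℝ) =
      ∑ f : Fin n → Fin q, (if ColorEdge f a c then (1 : ℝ) else 0) *
        (if ColorEdge f b d then (1 : ℝ) else 0) := by
    simp only [ite_zero_mul_ite_zero, mul_one, sum_boole]
  have conv : ∀ u v u' v' : Bool,
      ∑ f : Fin n → Fin q, (if ClearPair u v f a c then (1 : ℝ) else 0) *
        (if ClearPair u' v' f b d then (1 : ℝ) else 0) =
      (#{f : Fin n → Fin q | ClearPair u v f a c ∧ ClearPair u' v' f b d} : ℝ) := by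
    intro u v u' v'
    simp only [ite_zero_mul_ite_zero, mul_one, sum_boole]
  rw [expand]
  simp only [indicator_colorEdge, add_mul, sub_mul, mul_add, mul_sub, sum_add_distrib,
    sum_sub_distrib, conv, k1, k2, k3, k4, k5, k6, k7, k8, k9]
  ring_nf

theorem sum_range_ite_lt {n d : ℕ} (h : d ≤ n) (g : ℕ → ℝ) :
    ∑ c ∈ range n, (if c < d then g c else 0) = ∑ c ∈ range d, g c := by
  rw [← sum_filter]
  congr 1
  ext c
  simp only [mem_filter, mem_range]
  omega

theorem sum_fin_four_lt (n : ℕ) (g : ℕ → ℕ → ℕ → ℕ → ℝ) :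
    ∑ d : Fin n, ∑ c : Fin n, ∑ b : Fin n, ∑ a : Fin n,
      (if a < b ∧ b < c ∧ c < d then g a b c d else 0) =
    ∑ d ∈ range n, ∑ c ∈ range d, ∑ b ∈ range c, ∑ a ∈ range b, g a b c d := by
  have : ∀ d c b a : Fin n, (if a < b ∧ b < c ∧ c < d then g a b c d else 0) =
      if (c : ℕ) < d then (if (b : ℕ) < c then (if (a : ℕ) < b then g a b c d else 0) else 0)
        else 0 := by
    intro d c b a
    simp only [Fin.lt_def]
    split_ifs <;> first | rfl | omega
  simp only [this]
  rw [Fin.sum_univ_eq_sum_range (fun d => ∑ c : Fin n, ∑ b : Fin n, ∑ a : Fin n,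
    if (c : ℕ) < d then (if (b : ℕ) < c then (if (a : ℕ) < b then g a b c d else 0) else 0)
        else 0) n]
  refine sum_congr rfl fun d hd => ?_
  rw [Fin.sum_univ_eq_sum_range (fun c => ∑ b : Fin n, ∑ a : Fin n,
    if c < d then (if (b : ℕ) < c then (if (a : ℕ) < b then g a b c d else 0) else 0)
        else 0) n, ← sum_range_ite_lt (mem_range.mp hd).le]
  refine sum_congr rfl fun c hc => ?_
  split_ifs with hcd
  · rw [Fin.sum_univ_eq_sum_range (fun b => ∑ a : Fin n,
      if b < c then (if (a : ℕ) < b then g a b c d else 0) else 0) n,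
      ← sum_range_ite_lt (mem_range.mp hc).le]
    refine sum_congr rfl fun b hb => ?_
    split_ifs with hbc
    · rw [Fin.sum_univ_eq_sum_range (fun a => if a < b then g a b c d else 0) n,
        sum_range_ite_lt (mem_range.mp hb).le]
    · simp
  · simp

/-- The number of circular crossings of a colouring. -/
def colorCro {n q : ℕ} (f : Fin n → Fin q) : ℕ :=
  ∑ d : Fin n, ∑ c : Fin n, ∑ b : Fin n, ∑ a : Fin n,
    if (a < b ∧ b < c ∧ c < d) ∧ ColorEdge f a c ∧ ColorEdge f b d then 1 else 0

theorem sum_colorCro (n q : ℕ) :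
    (∑ f : Fin n → Fin q, (colorCro f : ℝ)) =
      q * (q - 1) * ((1 / 2) * choosePow q 1 n + 2 * choosePow (q - 1) 1 n
        - 4 * choosePow (q - 1) 2 n - (5 / 2) * choosePow (q - 2) 1 n
        - 2 * choosePow (q - 2) 2 n + choosePow (q - 2) 4 n) := by
  have h := congrFun (fourGaps_inclusion_exclusion q) n
  simp only [Pi.add_apply, Pi.sub_apply, Pi.smul_apply, smul_eq_mul] at h
  rw [← h]
  simp only [fourGaps_apply, ← sum_add_distrib, ← sum_sub_distrib, mul_sum]
  rw [← sum_fin_four_lt n]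
  simp only [colorCro]
  push_cast
  -- The sum over colourings is moved inside the sums over the four positions, one position at a
  -- time.
  rw [sum_comm]
  refine sum_congr rfl fun d _ => ?_
  rw [sum_comm]
  refine sum_congr rfl fun c _ => ?_
  rw [sum_comm]
  refine sum_congr rfl fun b _ => ?_
  rw [sum_comm]
  refine sum_congr rfl fun a _ => ?_
  split_ifs with habc
  · simp only [habc, true_and, and_self, sum_boole]
    rw [sum_colorEdge_colorEdge q habc.1 habc.2.1 habc.2.2 _ fun _ _ _ _ => rfl]
  · simp [habc]

/-! ### From colourings to set partitions. -/

section Partition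

variable {n q : ℕ}

theorem succ_mem_Icc (x : Fin n) : (x : ℕ) + 1 ∈ Icc 1 n := by
  simp only [mem_Icc]; omega

theorem exists_fin_of_mem_Icc {p : ℕ} (hp : p ∈ Icc 1 n) : ∃ z : Fin n, (z : ℕ) + 1 = p := by
  rw [mem_Icc] at hp
  exact ⟨⟨p - 1, by omega⟩, by simp; omega⟩

/-- Singleton blocks contribute loops `(i, i)`, which no crossing uses. For `i < j`, being the
minimum and maximum of the block means that no element of it lies outside `[i, j]`, the outside
clearance of colourings. -/
theorem mem_circularEdges_iff_of_lt {s : Finset ℕ} (P : Finpartition s) {i j : ℕ} (hij : i < j) :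
    (i, j) ∈ circularEdges P ↔ ∃ B ∈ P.parts, i ∈ B ∧ j ∈ B ∧
      ((∀ p ∈ B, ¬ (i < p ∧ p < j)) ∨ ∀ p ∈ B, ¬ (p < i ∨ j < p)) := by
  simp only [circularEdges, blockCircularEdges, mem_biUnion, mem_filter, mem_product, hij,
    true_and, and_assoc, not_or, not_lt, forall_and]

theorem colorEdge_iff_mem_circularEdges (P : Finpartition (Icc 1 n)) (f : Fin n → Fin q)
    (hf : ∀ x y : Fin n, f x = f y ↔ P.part (x + 1) = P.part (y + 1)) {i j : Fin n} (hij : i < j) :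
    ColorEdge f i j ↔ ((i : ℕ) + 1, (j : ℕ) + 1) ∈ circularEdges P := by
  have hmem : ∀ x y : Fin n, (y : ℕ) + 1 ∈ P.part (x + 1) ↔ f y = f x := fun x y => by
    rw [hf, P.mem_part_iff_part_eq_part (succ_mem_Icc y) (succ_mem_Icc x), eq_comm]
  rw [mem_circularEdges_iff_of_lt P (by simpa using hij)]
  have hall : ∀ R : ℕ → Prop, (∀ p ∈ P.part (i + 1), ¬ R p) ↔
      ∀ x : Fin n, R (x + 1) → f x ≠ f i := by
    intro R
    constructor
    · intro h x hR hx
      exact h _ ((hmem i x).mpr hx) hR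
    · intro h p hp hR
      obtain ⟨z, rfl⟩ := exists_fin_of_mem_Icc (P.part_subset _ hp)
      exact h z hR ((hmem i z).mp hp)
  have hB : (∃ B ∈ P.parts, (i : ℕ) + 1 ∈ B ∧ (j : ℕ) + 1 ∈ B ∧
      ((∀ p ∈ B, ¬ ((i : ℕ) + 1 < p ∧ p < (j : ℕ) + 1)) ∨
        ∀ p ∈ B, ¬ (p < (i : ℕ) + 1 ∨ (j : ℕ) + 1 < p))) ↔
      (j : ℕ) + 1 ∈ P.part (i + 1) ∧
      ((∀ p ∈ P.part (i + 1), ¬ ((i : ℕ) + 1 < p ∧ p < (j : ℕ) + 1)) ∨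
        ∀ p ∈ P.part (i + 1), ¬ (p < (i : ℕ) + 1 ∨ (j : ℕ) + 1 < p)) := by
    constructor
    · rintro ⟨B, hB, hi, h⟩
      rw [P.part_eq_of_mem hB hi]
      exact h
    · intro h
      exact ⟨_, P.part_mem.mpr (succ_mem_Icc i), P.mem_part_self.mpr (succ_mem_Icc i), h⟩
  rw [hB, hmem, hall, hall]
  simp only [ColorEdge, ClearPair, InsideOutside, add_lt_add_iff_right, ← and_or_left,
    eq_comm (a := f j)]
  simp

theorem cro_eq_colorCro (P : Finpartition (Icc 1 n)) (f : Fin n → Fin q)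
    (hf : ∀ x y : Fin n, f x = f y ↔ P.part (x + 1) = P.part (y + 1)) :
    cro P = colorCro f := by
  have h : colorCro f = #{p : Fin n × Fin n × Fin n × Fin n |
      (p.2.2.2 < p.2.2.1 ∧ p.2.2.1 < p.2.1 ∧ p.2.1 < p.1) ∧ ColorEdge f p.2.2.2 p.2.1 ∧
        ColorEdge f p.2.2.1 p.1} := by
    simp only [card_filter, colorCro, Fintype.sum_prod_type]
  rw [h, cro]
  symm
  refine card_bij (fun p _ => (((p.2.2.2 : ℕ) + 1, (p.2.1 : ℕ) + 1),
    ((p.2.2.1 : ℕ) + 1, (p.1 : ℕ) + 1))) ?_ ?_ ?_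
  · rintro ⟨d, c, b, a⟩ hp
    simp only [mem_filter, mem_univ, true_and] at hp
    obtain ⟨⟨hab, hbc, hcd⟩, h1, h2⟩ := hp
    simp only [circularCrossings, mem_filter, mem_product, add_lt_add_iff_right]
    exact ⟨⟨(colorEdge_iff_mem_circularEdges P f hf (hab.trans hbc)).mp h1,
      (colorEdge_iff_mem_circularEdges P f hf (hbc.trans hcd)).mp h2⟩, hab, hbc, hcd⟩
  · rintro ⟨d, c, b, a⟩ _ ⟨d', c', b', a'⟩ _ h
    simp only [Prod.mk.injEq, Nat.add_right_cancel_iff, Fin.val_inj] at h ⊢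
    tauto
  · rintro ⟨⟨a, c⟩, ⟨b, d⟩⟩ h
    simp only [circularCrossings, mem_filter, mem_product] at h
    obtain ⟨⟨h1, h2⟩, hab, hbc, hcd⟩ := h
    have hs : ∀ i j : ℕ, i < j → (i, j) ∈ circularEdges P → i ∈ Icc 1 n ∧ j ∈ Icc 1 n := by
      intro i j hij hm
      obtain ⟨B, hB, hi, hj, _⟩ := (mem_circularEdges_iff_of_lt P hij).mp hm
      exact ⟨P.subset hB hi, P.subset hB hj⟩
    obtain ⟨ha, hc⟩ := hs a c (hab.trans hbc) h1
    obtain ⟨hb, hd⟩ := hs b d (hbc.trans hcd) h2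
    obtain ⟨a, rfl⟩ := exists_fin_of_mem_Icc ha
    obtain ⟨b, rfl⟩ := exists_fin_of_mem_Icc hb
    obtain ⟨c, rfl⟩ := exists_fin_of_mem_Icc hc
    obtain ⟨d, rfl⟩ := exists_fin_of_mem_Icc hd
    simp only [add_lt_add_iff_right, Fin.val_fin_lt] at hab hbc hcd
    refine ⟨(d, c, b, a), ?_, rfl⟩
    simp only [mem_filter, mem_univ, true_and]
    exact ⟨⟨hab, hbc, hcd⟩, (colorEdge_iff_mem_circularEdges P f hf (hab.trans hbc)).mpr h1,
      (colorEdge_iff_mem_circularEdges P f hf (hbc.trans hcd)).mpr h2⟩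

/-- The colouring of `{1, …, n}` (shifted to `Fin n`) induced by an injective colouring of the
blocks of a partition. -/
def blockColoring (P : Finpartition (Icc 1 n)) (e : P.parts ↪ Fin q) (x : Fin n) : Fin q :=
  e ⟨P.part (x + 1), P.part_mem.mpr (succ_mem_Icc x)⟩

theorem blockColoring_eq_iff (P : Finpartition (Icc 1 n)) (e : P.parts ↪ Fin q) (x y : Fin n) :
    blockColoring P e x = blockColoring P e y ↔ P.part (x + 1) = P.part (y + 1) := by
  simp [blockColoring]

theorem Finpartition.ext_of_part_eq_iff {s : Finset ℕ} {P Q : Finpartition s}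
    (h : ∀ x ∈ s, ∀ y ∈ s, P.part x = P.part y ↔ Q.part x = Q.part y) : P = Q := by
  have key : ∀ x ∈ s, P.part x = Q.part x := by
    intro x hx
    ext y
    by_cases hy : y ∈ s
    · rw [P.mem_part_iff_part_eq_part hy hx, Q.mem_part_iff_part_eq_part hy hx]
      exact h y hy x hx
    · exact ⟨fun h => absurd (P.part_subset _ h) hy, fun h => absurd (Q.part_subset _ h) hy⟩
  have sub : ∀ P Q : Finpartition s, (∀ x ∈ s, P.part x = Q.part x) → P.parts ⊆ Q.parts := by
    intro P Q key B hB
    obtain ⟨x, hx⟩ := P.nonempty_of_mem_parts hB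
    rw [← P.part_eq_of_mem hB hx, key x (P.subset hB hx)]
    exact Q.part_mem.mpr (P.subset hB hx)
  ext B
  exact ⟨fun hB => sub P Q key hB, fun hB => sub Q P (fun x hx => (key x hx).symm) hB⟩

theorem blockColoring_bijective (n q : ℕ) :
    Function.Bijective (fun p : Σ P : Finpartition (Icc 1 n), P.parts ↪ Fin q =>
      blockColoring p.1 p.2) := by
  classical
  constructor
  · rintro ⟨P, e⟩ ⟨Q, e'⟩ h
    simp only at h
    obtain rfl : P = Q := by
      refine Finpartition.ext_of_part_eq_iff fun x hx y hy => ?_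
      obtain ⟨x, rfl⟩ := exists_fin_of_mem_Icc hx
      obtain ⟨y, rfl⟩ := exists_fin_of_mem_Icc hy
      rw [← blockColoring_eq_iff P e, ← blockColoring_eq_iff Q e', h]
    congr 1
    ext ⟨B, hB⟩ : 1
    obtain ⟨p, hp⟩ := P.nonempty_of_mem_parts hB
    obtain ⟨x, rfl⟩ := exists_fin_of_mem_Icc (P.subset hB hp)
    have := congrFun h x
    simpa only [blockColoring, P.part_eq_of_mem hB hp] using this
  · intro f
    -- The colouring is extended to all of `ℕ` so that its kernel is a setoid there. Truncated
    -- subtraction makes `0` and `1` agree under `F`, which is harmless since `0 ∉ Icc 1 n`.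
    let F : ℕ → Option (Fin q) := fun p => if h : p - 1 < n then some (f ⟨p - 1, h⟩) else none
    have hF : ∀ x : Fin n, F (x + 1) = some (f x) := fun x => by simp [F]
    let P : Finpartition (Icc 1 n) := Finpartition.ofSetSetoid (Setoid.ker F) (Icc 1 n)
    have hP : ∀ x y : Fin n, P.part (x + 1) = P.part (y + 1) ↔ f x = f y := by
      intro x y
      rw [← P.mem_part_iff_part_eq_part (succ_mem_Icc x) (succ_mem_Icc y),
        Finpartition.mem_part_ofSetSetoid_iff_rel]
      have h1 : (Setoid.ker F) (y + 1) (x + 1) ↔ F (y + 1) = F (x + 1) := Iff.rfl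
      rw [hF, hF, Option.some_inj] at h1
      simp only [succ_mem_Icc, true_and]
      exact h1.trans eq_comm
    have hex : ∀ B : P.parts, ∃ x : Fin n, P.part (x + 1) = B := by
      rintro ⟨B, hB⟩
      obtain ⟨p, hp⟩ := P.nonempty_of_mem_parts hB
      obtain ⟨x, rfl⟩ := exists_fin_of_mem_Icc (P.subset hB hp)
      exact ⟨x, P.part_eq_of_mem hB hp⟩
    choose r hr using hex
    refine ⟨⟨P, ⟨fun B => f (r B), fun B C h => ?_⟩⟩, ?_⟩
    · rw [Subtype.ext_iff, ← hr B, ← hr C]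
      exact (hP _ _).mpr h
    · funext x
      simp only [blockColoring]
      exact (hP _ _).mp (hr _)

theorem sum_coloring_eq (g : (Fin n → Fin q) → ℝ) (g' : Finpartition (Icc 1 n) → ℝ)
    (h : ∀ P e, g (blockColoring P e) = g' P) :
    ∑ f, g f = ∑ P : Finpartition (Icc 1 n), (q.descFactorial #P.parts : ℝ) * g' P := by
  rw [← (Equiv.ofBijective _ (blockColoring_bijective n q)).sum_comp]
  simp only [Equiv.ofBijective_apply, h, Fintype.sum_sigma, sum_const, nsmul_eq_mul, card_univ,
    Fintype.card_embedding_eq, Fintype.card_fin, Fintype.card_coe]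

theorem sum_coloring_eq_sum_range (g : (Fin n → Fin q) → ℝ) (g' : Finpartition (Icc 1 n) → ℝ)
    (h : ∀ P e, g (blockColoring P e) = g' P) :
    ∑ f, g f = ∑ k ∈ range (n + 1), (q.descFactorial k : ℝ) *
      ∑ P : Finpartition (Icc 1 n) with #P.parts = k, g' P := by
  rw [sum_coloring_eq g g' h, ← sum_fiberwise_of_maps_to (g := fun P => #P.parts)
    (t := range (n + 1))]
  · refine sum_congr rfl fun k _ => ?_
    rw [mul_sum]
    refine sum_congr rfl fun P hP => ?_
    rw [(mem_filter.mp hP).2]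
  · intro P _
    have := P.card_parts_le_card
    simp only [Nat.card_Icc] at this
    simp only [mem_range]
    omega

end Partition

/-! ### Falling factorial expansions and Stirling numbers. -/

/-- The system is triangular: at `q = k` the terms of index above `k` vanish, those below agree by
induction, and the diagonal coefficient is `k!`. -/
theorem eq_of_sum_descFactorial_eq {N : ℕ} {x y : ℕ → ℝ}
    (h : ∀ q : ℕ, ∑ k ∈ range N, (q.descFactorial k : ℝ) * x k =
      ∑ k ∈ range N, (q.descFactorial k : ℝ) * y k) : ∀ k < N, x k = y k := by
  intro k
  induction k using Nat.strong_induction_on with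
  | _ k ih =>
    intro hk
    have hq := h k
    rw [← sub_eq_zero, ← sum_sub_distrib, sum_eq_single k] at hq
    · rw [← mul_sub, Nat.descFactorial_self] at hq
      have : ((k.factorial : ℕ) : ℝ) ≠ 0 := by exact_mod_cast k.factorial_ne_zero
      linarith [(mul_eq_zero.mp hq).resolve_left this]
    · intro j hj hjk
      rw [mem_range] at hj
      rcases lt_or_gt_of_ne hjk with hlt | hlt
      · rw [ih j hlt hj, sub_self]
      · rw [Nat.descFactorial_of_lt hlt]; simp
    · intro hn
      simp [hk] at hn

theorem cast_mul_descFactorial (q k : ℕ) :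
    (k : ℝ) * q.descFactorial k = q * q.descFactorial k - q.descFactorial (k + 1) := by
  rw [Nat.descFactorial_succ]
  rcases le_or_gt k q with h | h
  · push_cast [Nat.cast_sub h]; ring
  · simp [Nat.descFactorial_of_lt h]

theorem sum_descFactorial_stirlingSecond {n N : ℕ} (hN : n < N) (q : ℕ) :
    ∑ k ∈ range N, (q.descFactorial k : ℝ) * Nat.stirlingSecond n k = (q : ℝ) ^ n := by
  induction n generalizing N with
  | zero =>
    rw [sum_eq_single 0]
    · simp
    · intro k _ hk
      obtain ⟨k, rfl⟩ := Nat.exists_eq_succ_of_ne_zero hk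
      simp
    · simp [hN]
  | succ n ih =>
    obtain ⟨N, rfl⟩ := Nat.exists_eq_add_of_le' (show 1 ≤ N by omega)
    rw [sum_range_succ']
    have hstep : ∀ k, (q.descFactorial (k + 1) : ℝ) * Nat.stirlingSecond (n + 1) (k + 1) =
        (q * (q.descFactorial (k + 1) * Nat.stirlingSecond n (k + 1))
          - q.descFactorial (k + 2) * Nat.stirlingSecond n (k + 1))
          + q.descFactorial (k + 1) * Nat.stirlingSecond n k := by
      intro k
      rw [Nat.stirlingSecond_succ_succ]
      have := cast_mul_descFactorial q (k + 1)
      push_cast at this ⊢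
      linear_combination (Nat.stirlingSecond n (k + 1) : ℝ) * this
    simp only [hstep, sum_add_distrib, sum_sub_distrib, ← mul_sum]
    have e1 := ih (show n < N + 1 by omega)
    rw [sum_range_succ'] at e1
    have e2 : ∑ k ∈ range N, (q.descFactorial (k + 2) : ℝ) * Nat.stirlingSecond n (k + 1) =
        ∑ k ∈ range N, (q.descFactorial (k + 1) : ℝ) * Nat.stirlingSecond n k
          - q * Nat.stirlingSecond n 0 := by
      have := sum_range_succ' (fun k => (q.descFactorial (k + 1) : ℝ) * Nat.stirlingSecond n k) N
      rw [sum_range_succ, Nat.stirlingSecond_eq_zero_of_lt (show n < N by omega)] at this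
      simp only [zero_add, Nat.descFactorial_one, Nat.cast_zero, mul_zero, add_zero] at this
      linarith
    rw [e2]
    simp only [Nat.descFactorial_zero, Nat.cast_one, one_mul, Nat.stirlingSecond_succ_zero,
      Nat.cast_zero, add_zero] at e1 ⊢
    rw [pow_succ]
    linear_combination (q : ℝ) * e1

theorem stirlingS_natCast (m l : ℕ) : stirlingS m l = Nat.stirlingSecond m l := by
  simp [stirlingS]

theorem bellB_natCast (m : ℕ) : bellB m = Nat.bell m := by
  simp [bellB]

theorem sum_mul_stirlingS_shift (φ : ℕ → ℝ) {a b n : ℕ} (hba : b ≤ a) (han : a ≤ n) :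
    ∑ k ∈ range (n + 1), φ k * stirlingS ((n : ℤ) - a) ((k : ℤ) - b) =
      ∑ j ∈ range (n + 1 - b), φ (b + j) * Nat.stirlingSecond (n - a) j := by
  obtain ⟨m, rfl⟩ := Nat.exists_eq_add_of_le han
  rw [← sum_range_add_sum_Ico _ (show b ≤ a + m + 1 by omega), sum_eq_zero, zero_add,
    sum_Ico_eq_sum_range]
  · refine sum_congr rfl fun j _ => ?_
    rw [show ((a + m : ℕ) : ℤ) - a = (m : ℕ) by push_cast; ring,
      show ((b + j : ℕ) : ℤ) - b = (j : ℕ) by push_cast; ring, stirlingS_natCast,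
      show a + m - a = m by omega]
  · intro k hk
    rw [mem_range] at hk
    rw [stirlingS, if_neg (by omega)]
    simp

/-- From `(q)_{b+j} = (q)_b * (q-b)_j` and the expansion of `(q - b) ^ (n - a)` in falling
factorials. It translates Stirling terms into the `choosePow` terms of `sum_colorCro`. -/
theorem sum_descFactorial_choose_stirlingS {a b : ℕ} (hba : b ≤ a) (n q : ℕ) :
    ∑ k ∈ range (n + 1), (q.descFactorial k : ℝ) *
        (n.choose a * stirlingS ((n : ℤ) - a) ((k : ℤ) - b)) =
      q.descFactorial b * choosePow (q - b) a n := by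
  rcases lt_or_ge n a with h | h
  · simp [choosePow, Nat.choose_eq_zero_of_lt h]
  rcases lt_or_ge q b with hq | hq
  · rw [Nat.descFactorial_of_lt hq, Nat.cast_zero, zero_mul]
    refine sum_eq_zero fun k _ => ?_
    rcases lt_or_ge k b with hk | hk
    · rw [stirlingS, if_neg (by omega)]; simp
    · rw [Nat.descFactorial_of_lt (by omega)]; simp
  have hsum := sum_mul_stirlingS_shift (fun k => (q.descFactorial k : ℝ)) hba h
  calc _ = (n.choose a : ℝ) * ∑ k ∈ range (n + 1), (q.descFactorial k : ℝ) *
        stirlingS ((n : ℤ) - a) ((k : ℤ) - b) := by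
        rw [mul_sum]; exact sum_congr rfl fun _ _ => by ring
    _ = (n.choose a : ℝ) * (q.descFactorial b * ∑ j ∈ range (n + 1 - b),
        ((q - b).descFactorial j : ℝ) * Nat.stirlingSecond (n - a) j) := by
        rw [hsum, mul_sum (range (n + 1 - b)) _ (q.descFactorial b : ℝ)]
        congr 1
        refine sum_congr rfl fun j _ => ?_
        rw [← Nat.descFactorial_mul_descFactorial (show b ≤ b + j by omega),
          Nat.add_sub_cancel_left]
        push_cast; ring
    _ = _ := by
        rw [sum_descFactorial_stirlingSecond (by omega), choosePow, Nat.cast_sub hq]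
        ring

/-- From `k * (q)_k = q * ((q)_k - (q-1)_k)`: the factor `k` costs one more use of the previous
lemma, at `q - 1`. -/
theorem sum_cast_mul_descFactorial_choose_stirlingS {a b : ℕ} (hba : b ≤ a) (n q : ℕ) :
    ∑ k ∈ range (n + 1), (q.descFactorial k : ℝ) *
        (k * (n.choose a * stirlingS ((n : ℤ) - a) ((k : ℤ) - b))) =
      q.descFactorial b * (q * choosePow (q - b) a n - (q - b) * choosePow (q - b - 1) a n) := by
  have h0 := sum_descFactorial_choose_stirlingS hba n q
  rcases Nat.eq_zero_or_pos q with rfl | hq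
  · rw [sum_eq_zero]
    · rcases Nat.eq_zero_or_pos b with rfl | hb
      · simp
      · simp [Nat.descFactorial_of_lt hb]
    · intro k _
      rcases Nat.eq_zero_or_pos k with rfl | hk
      · simp
      · simp [Nat.descFactorial_of_lt hk]
  obtain ⟨p, rfl⟩ := Nat.exists_eq_add_of_le' hq
  have h1 := sum_descFactorial_choose_stirlingS hba n p
  have hsucc : ∀ k : ℕ, (k : ℝ) * (p + 1).descFactorial k =
      (p + 1 : ℕ) * (p + 1).descFactorial k - (p + 1 : ℕ) * p.descFactorial k := by
    intro k
    rw [cast_mul_descFactorial, Nat.succ_descFactorial_succ]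
    push_cast; ring
  have hb := hsucc b
  calc _ = (p + 1 : ℕ) * ∑ k ∈ range (n + 1), ((p + 1).descFactorial k : ℝ) *
        (n.choose a * stirlingS ((n : ℤ) - a) ((k : ℤ) - b)) - (p + 1 : ℕ) *
        ∑ k ∈ range (n + 1), (p.descFactorial k : ℝ) *
        (n.choose a * stirlingS ((n : ℤ) - a) ((k : ℤ) - b)) := by
        rw [mul_sum, mul_sum, ← sum_sub_distrib]
        refine sum_congr rfl fun k _ => ?_
        linear_combination (n.choose a * stirlingS ((n : ℤ) - a) ((k : ℤ) - b) : ℝ) * hsucc k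
    _ = _ := by
        rw [h0, h1]
        push_cast at hb ⊢
        rw [show ((p : ℝ) + 1 - b - 1) = p - b by ring]
        linear_combination -choosePow ((p : ℝ) - b) a n * hb

/-- Used to absorb the factors `n` of `totalCro` into binomial coefficients, where `sum_colorCro`
has none. -/
theorem cast_mul_choosePow (w : ℝ) (j n : ℕ) :
    (n : ℝ) * choosePow w j n = j * choosePow w j n + (j + 1) * (w * choosePow w (j + 1) n) := by
  simp only [choosePow]
  rcases lt_or_ge n j with h | h
  · simp [Nat.choose_eq_zero_of_lt h, Nat.choose_eq_zero_of_lt (h.trans (Nat.lt_succ_self j))]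
  rcases h.eq_or_lt with rfl | h
  · simp
  have := Nat.choose_succ_right_eq n j
  have hc : (n.choose (j + 1) : ℝ) * (j + 1) = n.choose j * (n - j) := by
    rw [← Nat.cast_sub h.le]; exact_mod_cast this
  rw [show n - j = n - (j + 1) + 1 by omega, pow_succ]
  linear_combination (-w ^ (n - (j + 1)) * w) * hc

/-! ### Total crossings for a given number of blocks. -/

/-- The total number of circular crossings over all partitions of `{1, …, n}` into `k` blocks. -/
noncomputable def totalCro (n k : ℕ) : ℝ :=
  1 / 2 * (n : ℝ) * ((k : ℝ) - 1) * stirlingS n k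
    - 1 / 2 * (n : ℝ) * (4 * (n : ℝ) - 5 * (k : ℝ) + 1) * stirlingS ((n : ℤ) - 1) ((k : ℤ) - 1)
    - 2 * (n.choose 2 : ℝ) * stirlingS ((n : ℤ) - 2) ((k : ℤ) - 2)
    + (n.choose 4 : ℝ) * stirlingS ((n : ℤ) - 4) ((k : ℤ) - 2)

/-- The weight `φ` is left free for two uses: falling factorials, to identify the coefficients, and
the constant `1`, to pass to Bell numbers. -/
theorem sum_mul_totalCro (n : ℕ) (φ : ℕ → ℝ) (t00 s00 t11 s11 t22 t42 : ℝ)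
    (h00 : ∑ k ∈ range (n + 1), φ k * (n.choose 0 * stirlingS ((n : ℤ) - (0 : ℕ))
      ((k : ℤ) - (0 : ℕ))) = t00)
    (h00' : ∑ k ∈ range (n + 1), φ k * (k * (n.choose 0 * stirlingS ((n : ℤ) - (0 : ℕ))
      ((k : ℤ) - (0 : ℕ)))) = s00)
    (h11 : ∑ k ∈ range (n + 1), φ k * (n.choose 1 * stirlingS ((n : ℤ) - (1 : ℕ))
      ((k : ℤ) - (1 : ℕ))) = t11)
    (h11' : ∑ k ∈ range (n + 1), φ k * (k * (n.choose 1 * stirlingS ((n : ℤ) - (1 : ℕ))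
      ((k : ℤ) - (1 : ℕ)))) = s11)
    (h22 : ∑ k ∈ range (n + 1), φ k * (n.choose 2 * stirlingS ((n : ℤ) - (2 : ℕ))
      ((k : ℤ) - (2 : ℕ))) = t22)
    (h42 : ∑ k ∈ range (n + 1), φ k * (n.choose 4 * stirlingS ((n : ℤ) - (4 : ℕ))
      ((k : ℤ) - (2 : ℕ))) = t42) :
    ∑ k ∈ range (n + 1), φ k * totalCro n k =
      1 / 2 * n * (s00 - t00) - 1 / 2 * ((4 * n + 1) * t11 - 5 * s11) - 2 * t22 + t42 := by
  rw [← h00, ← h00', ← h11, ← h11', ← h22, ← h42]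
  simp only [mul_sum, ← sum_sub_distrib, ← sum_add_distrib]
  refine sum_congr rfl fun k _ => ?_
  simp only [totalCro, Nat.choose_zero_right, Nat.choose_one_right, Nat.cast_zero, sub_zero,
    Nat.cast_one, Nat.cast_ofNat]
  ring

theorem sum_cro_eq_totalCro {n k : ℕ} (hk : k < n + 1) :
    ∑ P : Finpartition (Icc 1 n) with #P.parts = k, (cro P : ℝ) = totalCro n k := by
  suffices key : ∀ q : ℕ, ∑ k ∈ range (n + 1), (q.descFactorial k : ℝ) *
      ∑ P : Finpartition (Icc 1 n) with #P.parts = k, (cro P : ℝ) =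
      ∑ k ∈ range (n + 1), (q.descFactorial k : ℝ) * totalCro n k from
    eq_of_sum_descFactorial_eq key k hk
  intro q
  rw [← sum_coloring_eq_sum_range (fun f : Fin n → Fin q => (colorCro f : ℝ)), sum_colorCro,
    sum_mul_totalCro n _ _ _ _ _ _ _
      (sum_descFactorial_choose_stirlingS le_rfl n q)
      (sum_cast_mul_descFactorial_choose_stirlingS le_rfl n q)
      (sum_descFactorial_choose_stirlingS le_rfl n q)
      (sum_cast_mul_descFactorial_choose_stirlingS le_rfl n q)
      (sum_descFactorial_choose_stirlingS le_rfl n q)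
      (sum_descFactorial_choose_stirlingS (by norm_num) n q)]
  · have e2 : (q.descFactorial 2 : ℝ) = q * (q - 1) := by
      have := cast_mul_descFactorial q 1
      simp only [Nat.descFactorial_one, Nat.cast_one, one_mul, Nat.reduceAdd] at this
      linarith
    have r1 := cast_mul_choosePow q 0 n
    have r2 := cast_mul_choosePow (q - 1) 0 n
    have r3 := cast_mul_choosePow (q - 1) 1 n
    rw [e2]
    simp only [Nat.descFactorial_zero, Nat.descFactorial_one, Nat.cast_one, Nat.cast_zero,
      Nat.cast_ofNat, sub_zero, zero_mul, zero_add, one_mul, Nat.reduceAdd,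
      show (q : ℝ) - 1 - 1 = q - 2 by ring] at r1 r2 r3 ⊢
    linear_combination (-1 / 2 * (q - 1) : ℝ) * r1 + (1 / 2 * q : ℝ) * r2 + (2 * q : ℝ) * r3
  · intro P e
    rw [cro_eq_colorCro P _ (blockColoring_eq_iff P e)]

theorem card_partitions_eq_stirlingSecond {n k : ℕ} (hk : k < n + 1) :
    (#{P : Finpartition (Icc 1 n) | #P.parts = k} : ℝ) = Nat.stirlingSecond n k := by
  refine eq_of_sum_descFactorial_eq (x := fun k =>
    (#{P : Finpartition (Icc 1 n) | #P.parts = k} : ℝ)) (y := fun k => (Nat.stirlingSecond n k : ℝ))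
    (fun q => ?_) k hk
  rw [sum_descFactorial_stirlingSecond (Nat.lt_succ_self n)]
  have := sum_coloring_eq_sum_range (n := n) (q := q) (fun _ => 1) (fun _ => 1) (by simp)
  simp only [sum_const, card_univ, nsmul_eq_mul, mul_one, Fintype.card_fun, Fintype.card_fin] at this
  rw [← this]
  push_cast
  rfl

/-! ### Dobinski's formula and Bell number sums. -/

theorem hasSum_descFactorial_div_factorial (k : ℕ) :
    HasSum (fun q : ℕ => (q.descFactorial k : ℝ) / q.factorial) (Real.exp 1) := by
  have h : HasSum (fun q : ℕ => (1 : ℝ) / q.factorial) (Real.exp 1) := by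
    have := NormedSpace.expSeries_div_hasSum_exp (𝔸 := ℝ) 1
    simpa [Real.exp_eq_exp_ℝ] using this
  have hz : ∑ q ∈ range k, (q.descFactorial k : ℝ) / q.factorial = 0 :=
    sum_eq_zero fun q hq => by rw [Nat.descFactorial_of_lt (mem_range.mp hq)]; simp
  have := (hasSum_nat_add_iff (f := fun q : ℕ => (q.descFactorial k : ℝ) / q.factorial) k
    (g := Real.exp 1)).mp ?_
  · rwa [hz, add_zero] at this
  · rw [show (fun q : ℕ => ((q + k).descFactorial k : ℝ) / (q + k).factorial) =
      fun q : ℕ => (1 : ℝ) / q.factorial from funext fun q => ?_]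
    · exact h
    have hf := Nat.factorial_mul_descFactorial (show k ≤ q + k by omega)
    rw [Nat.add_sub_cancel] at hf
    rw [div_eq_div_iff (by positivity) (by positivity), one_mul, mul_comm]
    exact_mod_cast hf

theorem hasSum_pow_div_factorial_stirling (n : ℕ) :
    HasSum (fun q : ℕ => (q : ℝ) ^ n / q.factorial)
      (Real.exp 1 * ∑ k ∈ range (n + 1), (Nat.stirlingSecond n k : ℝ)) := by
  rw [mul_sum]
  have := hasSum_sum (s := range (n + 1)) fun k _ =>
    (hasSum_descFactorial_div_factorial k).mul_right (Nat.stirlingSecond n k : ℝ)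
  refine (funext fun q => ?_ : _ = fun q : ℕ => (q : ℝ) ^ n / q.factorial) ▸ this
  rw [← sum_descFactorial_stirlingSecond (Nat.lt_succ_self n), sum_div]
  exact sum_congr rfl fun _ _ => by ring

theorem hasSum_succ_pow_div_factorial_iff (n : ℕ) (s : ℝ) :
    HasSum (fun q : ℕ => ((q : ℝ) + 1) ^ n / q.factorial) s ↔
      HasSum (fun q : ℕ => (q : ℝ) ^ (n + 1) / q.factorial) s := by
  have := hasSum_nat_add_iff (f := fun q : ℕ => (q : ℝ) ^ (n + 1) / q.factorial) 1 (g := s)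
  simp only [range_one, sum_singleton, Nat.cast_zero, ne_eq, Nat.add_eq_zero_iff, one_ne_zero,
    and_false, not_false_eq_true, zero_pow, zero_div, add_zero] at this
  rw [← this]
  refine iff_of_eq (congrArg (fun f => HasSum f s) (funext fun q => ?_))
  rw [Nat.factorial_succ]
  push_cast
  rw [pow_succ]
  field_simp

/-- Shifting the Dobinski series gives `∑ (q + 1) ^ n / q!`; expanding binomially shows that the
Stirling sums satisfy the Bell recurrence. -/
theorem sum_stirlingSecond_eq_bell (n : ℕ) :
    ∑ k ∈ range (n + 1), (Nat.stirlingSecond n k : ℝ) = Nat.bell n := by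
  induction n using Nat.strong_induction_on with
  | _ n ih =>
    rcases n with _ | n
    · simp
    have h1 := (hasSum_succ_pow_div_factorial_iff n _).mpr
      (hasSum_pow_div_factorial_stirling (n + 1))
    have h2 := hasSum_sum (s := range (n + 1)) fun i _ =>
      (hasSum_pow_div_factorial_stirling i).mul_right (n.choose i : ℝ)
    have h3 : (fun q : ℕ => ∑ i ∈ range (n + 1), (q : ℝ) ^ i / q.factorial * n.choose i) =
        fun q : ℕ => ((q : ℝ) + 1) ^ n / q.factorial := by
      funext q
      rw [add_pow, sum_div]
      exact sum_congr rfl fun _ _ => by rw [one_pow]; ring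
    rw [h3] at h2
    have h4 := h1.unique h2
    have h5 : ∑ k ∈ range (n + 1 + 1), (Nat.stirlingSecond (n + 1) k : ℝ) =
        ∑ i ∈ range (n + 1), (n.choose i : ℝ) * Nat.bell i := by
      refine mul_left_cancel₀ (Real.exp_ne_zero 1) ?_
      rw [h4, mul_sum]
      refine sum_congr rfl fun i hi => ?_
      rw [ih i (mem_range.mp hi)]
      ring
    rw [h5, Nat.bell_succ', ← Nat.sum_antidiagonal_swap]
    rw [Finset.Nat.sum_antidiagonal_eq_sum_range_succ_mk]
    push_cast
    refine sum_congr rfl fun i hi => ?_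
    simp only [Prod.swap]
    rw [Nat.choose_symm (Nat.lt_succ_iff.mp (mem_range.mp hi))]

theorem hasSum_pow_div_factorial (n : ℕ) :
    HasSum (fun q : ℕ => (q : ℝ) ^ n / q.factorial) (Real.exp 1 * Nat.bell n) := by
  rw [← sum_stirlingSecond_eq_bell]
  exact hasSum_pow_div_factorial_stirling n

theorem bell_pos (n : ℕ) : 0 < Nat.bell n := by
  have h : (1 : ℝ) ≤ Nat.bell n := by
    rw [← sum_stirlingSecond_eq_bell, sum_range_succ, Nat.stirlingSecond_self]
    simp only [Nat.cast_one, le_add_iff_nonneg_left]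
    exact sum_nonneg fun _ _ => Nat.cast_nonneg _
  exact_mod_cast h

theorem sum_stirlingSecond_eq_bell_of_lt {n N : ℕ} (hN : n < N) :
    ∑ k ∈ range N, (Nat.stirlingSecond n k : ℝ) = Nat.bell n := by
  rw [← sum_stirlingSecond_eq_bell]
  symm
  refine sum_subset (range_subset_range.mpr hN) fun k _ hk => ?_
  rw [Nat.stirlingSecond_eq_zero_of_lt (by simpa using hk), Nat.cast_zero]

theorem sum_cast_mul_stirlingSecond {n N : ℕ} (hN : n < N) :
    ∑ k ∈ range N, (k : ℝ) * Nat.stirlingSecond n k = Nat.bell (n + 1) - Nat.bell n := by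
  rw [← sum_stirlingSecond_eq_bell_of_lt (show n + 1 < N + 1 by omega), sum_range_succ',
    ← sum_stirlingSecond_eq_bell_of_lt hN, eq_sub_iff_add_eq, ← sum_add_distrib]
  have h2 := sum_range_succ' (fun k => (k : ℝ) * Nat.stirlingSecond n k) N
  rw [sum_range_succ, Nat.stirlingSecond_eq_zero_of_lt hN] at h2
  simp only [Nat.cast_zero, mul_zero, zero_mul, add_zero] at h2
  rw [sum_add_distrib, h2, ← sum_add_distrib]
  simp [Nat.stirlingSecond_succ_succ]

theorem sum_choose_stirlingS {a b : ℕ} (hba : b ≤ a) (n : ℕ) :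
    ∑ k ∈ range (n + 1), (1 : ℝ) * (n.choose a * stirlingS ((n : ℤ) - a) ((k : ℤ) - b)) =
      n.choose a * bellB ((n : ℤ) - a) := by
  rcases lt_or_ge n a with h | h
  · simp [Nat.choose_eq_zero_of_lt h]
  have := sum_mul_stirlingS_shift (fun _ => n.choose a) hba h
  simp only [one_mul]
  rw [this, ← mul_sum, sum_stirlingSecond_eq_bell_of_lt (by omega),
    show (n : ℤ) - a = (n - a : ℕ) by omega, bellB_natCast]

theorem sum_cast_mul_choose_stirlingS {a b : ℕ} (hba : b ≤ a) (n : ℕ) :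
    ∑ k ∈ range (n + 1), (1 : ℝ) * (k * (n.choose a *
        stirlingS ((n : ℤ) - a) ((k : ℤ) - b))) =
      n.choose a * (bellB ((n : ℤ) - a + 1) + (b - 1) * bellB ((n : ℤ) - a)) := by
  rcases lt_or_ge n a with h | h
  · simp [Nat.choose_eq_zero_of_lt h]
  have := sum_mul_stirlingS_shift (fun k => k * n.choose a) hba h
  simp only [one_mul, ← mul_assoc]
  rw [this, show (n : ℤ) - a = (n - a : ℕ) by omega, bellB_natCast]
  rw [show ((n - a : ℕ) : ℤ) + 1 = ((n - a + 1 : ℕ) : ℤ) by push_cast; ring, bellB_natCast]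
  have h1 := sum_stirlingSecond_eq_bell_of_lt (show n - a < n + 1 - b by omega)
  have h2 := sum_cast_mul_stirlingSecond (show n - a < n + 1 - b by omega)
  rw [show ((n - a + 1).bell : ℝ) = ((n - a + 1).bell - (n - a).bell) + (n - a).bell by ring,
    ← h2, ← h1]
  simp only [mul_sum, ← sum_add_distrib]
  refine sum_congr rfl fun k _ => ?_
  push_cast
  ring

theorem sum_fiberwise_parts (n : ℕ) (g : Finpartition (Icc 1 n) → ℝ) :
    ∑ P, g P = ∑ k ∈ range (n + 1), ∑ P : Finpartition (Icc 1 n) with #P.parts = k, g P := by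
  refine (sum_fiberwise_of_maps_to (g := fun P : Finpartition (Icc 1 n) => #P.parts)
    (fun P _ => ?_) g).symm
  have := P.card_parts_le_card
  simp only [Nat.card_Icc] at this
  simp only [mem_range]
  omega

theorem card_finpartition_eq_bell (n : ℕ) :
    (Fintype.card (Finpartition (Icc 1 n)) : ℝ) = Nat.bell n := by
  have := sum_fiberwise_parts n fun _ => 1
  simp only [sum_const, nsmul_eq_mul, mul_one, card_univ] at this
  rw [this, ← sum_stirlingSecond_eq_bell]
  exact sum_congr rfl fun k hk => card_partitions_eq_stirlingSecond (mem_range.mp hk)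

/-! ### The two exact formulas. -/

theorem meanCro_eq (n : ℕ) : meanCro n =
    (n : ℝ) / 2 * ((bellB (n + 1) : ℝ) / (bellB n : ℝ)) + 3 * (n : ℝ) / 2
      - (n : ℝ) * (4 * (n : ℝ) + 1) / 2 * ((bellB ((n : ℤ) - 1) : ℝ) / (bellB n : ℝ))
      - 2 * (n.choose 2 : ℝ) * ((bellB ((n : ℤ) - 2) : ℝ) / (bellB n : ℝ))
      + (n.choose 4 : ℝ) * ((bellB ((n : ℤ) - 4) : ℝ) / (bellB n : ℝ)) := by
  have hb : (Nat.bell n : ℝ) ≠ 0 := by exact_mod_cast (bell_pos n).ne'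
  have hsum : ∑ P : Finpartition (Icc 1 n), (cro P : ℝ) =
      ∑ k ∈ range (n + 1), 1 * totalCro n k := by
    rw [sum_fiberwise_parts]
    exact sum_congr rfl fun k hk => by rw [sum_cro_eq_totalCro (mem_range.mp hk), one_mul]
  rw [meanCro, hsum, card_finpartition_eq_bell, sum_mul_totalCro n _ _ _ _ _ _ _
      (sum_choose_stirlingS le_rfl n) (sum_cast_mul_choose_stirlingS le_rfl n)
      (sum_choose_stirlingS le_rfl n) (sum_cast_mul_choose_stirlingS le_rfl n)
      (sum_choose_stirlingS le_rfl n) (sum_choose_stirlingS (by norm_num) n)]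
  simp only [Nat.choose_zero_right, Nat.choose_one_right, Nat.cast_zero, sub_zero, Nat.cast_one,
    Nat.cast_ofNat, sub_add_cancel, bellB_natCast]
  field_simp
  ring

theorem stirlingSecond_pos {n k : ℕ} (hk : 1 ≤ k) (hkn : k ≤ n) : 0 < Nat.stirlingSecond n k := by
  induction hkn with
  | refl => rw [Nat.stirlingSecond_self]; exact one_pos
  | step _ ih =>
    obtain ⟨k, rfl⟩ := Nat.exists_eq_add_of_le' hk
    rw [Nat.stirlingSecond_succ_succ]
    positivity

theorem meanCroBlocks_eq {n k : ℕ} (hk : 1 ≤ k) (hkn : k ≤ n) : meanCroBlocks n k =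
    1 / 2 * (n : ℝ) * ((k : ℝ) - 1)
      - 1 / 2 * (n : ℝ) * (4 * (n : ℝ) - 5 * (k : ℝ) + 1) *
          ((stirlingS ((n : ℤ) - 1) ((k : ℤ) - 1) : ℝ) / (stirlingS n k : ℝ))
      - 2 * (n.choose 2 : ℝ) *
          ((stirlingS ((n : ℤ) - 2) ((k : ℤ) - 2) : ℝ) / (stirlingS n k : ℝ))
      + (n.choose 4 : ℝ) *
          ((stirlingS ((n : ℤ) - 4) ((k : ℤ) - 2) : ℝ) / (stirlingS n k : ℝ)) := by
  have hs : (Nat.stirlingSecond n k : ℝ) ≠ 0 := by exact_mod_cast (stirlingSecond_pos hk hkn).ne'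
  rw [meanCroBlocks, sum_cro_eq_totalCro (by omega), card_partitions_eq_stirlingSecond (by omega),
    totalCro, stirlingS_natCast]
  field_simp

/-! ### Growth of the ratio of consecutive Bell numbers. -/

/-- The ratio of consecutive Bell numbers. -/
noncomputable def bellRatio (n : ℕ) : ℝ := (Nat.bell (n + 1) : ℝ) / Nat.bell n

theorem bellRatio_pos (n : ℕ) : 0 < bellRatio n := by
  have h1 := bell_pos n
  have h2 := bell_pos (n + 1)
  unfold bellRatio
  positivity

theorem bellRatio_mul_bell (n : ℕ) : bellRatio n * Nat.bell n = Nat.bell (n + 1) := by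
  have h1 := bell_pos n
  unfold bellRatio
  field_simp

theorem tangent_le_pow {y₀ y : ℝ} (h0 : 0 < y₀) (hy : 0 ≤ y) (n : ℕ) :
    y₀ ^ (n + 1) + (n + 1) * y₀ ^ n * (y - y₀) ≤ y ^ (n + 1) := by
  have h := one_add_mul_le_pow (a := (y - y₀) / y₀)
    (by rw [le_div_iff₀ h0]; linarith) (n + 1)
  have h1 := mul_le_mul_of_nonneg_left h (pow_pos h0 (n + 1)).le
  rw [← mul_pow, show y₀ * (1 + (y - y₀) / y₀) = y by field_simp; ring] at h1
  refine le_trans (le_of_eq ?_) h1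
  push_cast
  field_simp
  ring

/-- Jensen for the probability weights proportional to `q ^ n / q!`: both `q` and `(1 + 1/q) ^ n`
have mean `m = bellRatio n`, and the latter is convex in `q`. The proof integrates the tangent line
at `q = m`. -/
theorem one_add_inv_pow_le_bellRatio {n : ℕ} (hn : 1 ≤ n) :
    (1 + 1 / bellRatio n) ^ n ≤ bellRatio n := by
  obtain ⟨N, rfl⟩ := Nat.exists_eq_add_of_le' hn
  have hm := bellRatio_pos (N + 1)
  have hmb := bellRatio_mul_bell (N + 1)
  set m := bellRatio (N + 1)
  have hb : (0 : ℝ) < Nat.bell (N + 1) := by exact_mod_cast bell_pos _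
  have H1 := (hasSum_succ_pow_div_factorial_iff (N + 1) _).mpr (hasSum_pow_div_factorial (N + 2))
  -- Minus the slope of `(1 + 1/q) ^ (N + 1)` at `q = m`.
  set c := (N + 1) * (1 + 1 / m) ^ N / m ^ 2 with hc
  have hc0 : 0 ≤ c := by positivity
  have H2 := ((hasSum_pow_div_factorial (N + 1)).mul_left ((1 + 1 / m) ^ (N + 1) + c * m)).sub
    ((hasSum_pow_div_factorial (N + 2)).mul_left c)
  have key := hasSum_le (fun q => ?_) H2 H1
  · have e : ((1 + 1 / m) ^ (N + 1) + c * m) * (Real.exp 1 * Nat.bell (N + 1)) -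
        c * (Real.exp 1 * Nat.bell (N + 2)) =
        (Real.exp 1 * Nat.bell (N + 1)) * (1 + 1 / m) ^ (N + 1) := by
      rw [← hmb]; ring
    rw [e, ← hmb, ← mul_assoc, mul_right_comm, mul_comm] at key
    exact le_of_mul_le_mul_right (by linarith) (mul_pos (Real.exp_pos 1) hb)
  · rcases Nat.eq_zero_or_pos q with rfl | hq
    · simp
    have hq' : (0 : ℝ) < q := by exact_mod_cast hq
    have t1 := tangent_le_pow (show 0 < 1 + 1 / m by positivity)
      (show 0 ≤ 1 + 1 / (q : ℝ) by positivity) N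
    -- The convex function `1/q` lies above its tangent at `m`.
    have t2 : -((q - m) / m ^ 2) ≤ (1 + 1 / (q : ℝ)) - (1 + 1 / m) := by
      have : (1 + 1 / (q : ℝ)) - (1 + 1 / m) + (q - m) / m ^ 2 = (q - m) ^ 2 / (q * m ^ 2) := by
        field_simp; ring
      have h' : 0 ≤ (q - m) ^ 2 / (q * m ^ 2) := by positivity
      linarith
    have t3 := mul_le_mul_of_nonneg_left t2 (show 0 ≤ (N + 1) * (1 + 1 / m) ^ N by positivity)
    have t4 : (1 + 1 / m) ^ (N + 1) + c * m - c * q ≤ (1 + 1 / (q : ℝ)) ^ (N + 1) := by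
      refine le_trans ?_ (le_trans (add_le_add_right t3 _) t1)
      rw [hc]
      apply le_of_eq
      field_simp
      ring
    have t5 := mul_le_mul_of_nonneg_left t4
      (show 0 ≤ (q : ℝ) ^ (N + 1) / q.factorial by positivity)
    have e2 : (q : ℝ) ^ (N + 1) / q.factorial * (1 + 1 / (q : ℝ)) ^ (N + 1) =
        ((q : ℝ) + 1) ^ (N + 1) / q.factorial := by
      rw [div_mul_eq_mul_div, ← mul_pow]
      congr 2
      field_simp
    rw [e2] at t5
    refine le_trans (le_of_eq ?_) t5
    ring

theorem one_lt_bellRatio {n : ℕ} (hn : 1 ≤ n) : 1 < bellRatio n := by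
  have hm := bellRatio_pos n
  refine lt_of_lt_of_le ?_ (one_add_inv_pow_le_bellRatio hn)
  exact one_lt_pow₀ (by have : 0 < 1 / bellRatio n := by positivity
                        linarith) (by omega)

/-- Jensen for the weights proportional to `q ^ (n + 1) / q!`: both `1/q` and `(1 - 1/q) ^ n` have
mean `1/m`, and the latter is convex in `1/q`. -/
theorem bellRatio_mul_one_sub_inv_pow_le {n : ℕ} (hn : 1 ≤ n) :
    bellRatio n * (1 - 1 / bellRatio n) ^ n ≤ 1 := by
  have hm1 := one_lt_bellRatio hn
  obtain ⟨N, rfl⟩ := Nat.exists_eq_add_of_le' hn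
  have hm := bellRatio_pos (N + 1)
  have hmb := bellRatio_mul_bell (N + 1)
  set m := bellRatio (N + 1)
  have hb : (0 : ℝ) < Nat.bell (N + 1) := by exact_mod_cast bell_pos _
  have hy : 0 < 1 - 1 / m := by
    rw [sub_pos, div_lt_one hm]; exact hm1
  have H1 : HasSum (fun q : ℕ => (q : ℝ) * (q - 1) ^ (N + 1) / q.factorial)
      (Real.exp 1 * Nat.bell (N + 1)) := by
    have := (hasSum_nat_add_iff (f := fun q : ℕ => (q : ℝ) * (q - 1) ^ (N + 1) / q.factorial) 1
      (g := Real.exp 1 * Nat.bell (N + 1))).mp ?_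
    · simpa using this
    · rw [show (fun q : ℕ => ((q + 1 : ℕ) : ℝ) * ((q + 1 : ℕ) - 1) ^ (N + 1) / (q + 1).factorial) =
        fun q : ℕ => (q : ℝ) ^ (N + 1) / q.factorial from funext fun q => ?_]
      · exact hasSum_pow_div_factorial (N + 1)
      · rw [Nat.factorial_succ]
        push_cast
        rw [add_sub_cancel_right]
        field_simp
  set c := (N + 1) * (1 - 1 / m) ^ N with hc
  have H2 := ((hasSum_pow_div_factorial (N + 2)).mul_left ((1 - 1 / m) ^ (N + 1) + c / m)).sub
    ((hasSum_pow_div_factorial (N + 1)).mul_left c)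
  have key := hasSum_le (fun q => ?_) H2 H1
  · have e : ((1 - 1 / m) ^ (N + 1) + c / m) * (Real.exp 1 * Nat.bell (N + 2)) -
        c * (Real.exp 1 * Nat.bell (N + 1)) =
        m * (1 - 1 / m) ^ (N + 1) * (Real.exp 1 * Nat.bell (N + 1)) := by
      rw [← hmb]; field_simp; ring
    rw [e] at key
    exact le_of_mul_le_mul_right (by linarith) (mul_pos (Real.exp_pos 1) hb)
  · rcases Nat.eq_zero_or_pos q with rfl | hq
    · simp
    have hq' : (0 : ℝ) < q := by exact_mod_cast hq
    have hq1 : (1 : ℝ) ≤ q := by exact_mod_cast hq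
    have t1 := tangent_le_pow hy
      (show 0 ≤ 1 - 1 / (q : ℝ) by rw [sub_nonneg, div_le_one hq']; exact hq1) N
    have t5 := mul_le_mul_of_nonneg_left t1
      (show 0 ≤ (q : ℝ) ^ (N + 2) / q.factorial by positivity)
    have e2 : (q : ℝ) ^ (N + 2) / q.factorial * (1 - 1 / (q : ℝ)) ^ (N + 1) =
        (q : ℝ) * (q - 1) ^ (N + 1) / q.factorial := by
      rw [div_mul_eq_mul_div, pow_succ' _ (N + 1), mul_assoc, ← mul_pow]
      congr 3
      field_simp
    rw [e2] at t5
    refine le_trans (le_of_eq ?_) t5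
    rw [hc]
    field_simp
    ring

theorem le_bellRatio_add_one_mul_log {n : ℕ} (hn : 1 ≤ n) :
    (n : ℝ) ≤ (bellRatio n + 1) * Real.log (bellRatio n) := by
  have h := one_add_inv_pow_le_bellRatio hn
  have hm := bellRatio_pos n
  set m := bellRatio n
  have h1 := Real.log_le_log (by positivity) h
  rw [Real.log_pow] at h1
  have h2 := Real.one_sub_inv_le_log_of_pos (show 0 < 1 + 1 / m by positivity)
  have h3 : 1 - (1 + 1 / m)⁻¹ = 1 / (m + 1) := by field_simp; ring
  rw [h3] at h2
  have h4 := (mul_le_mul_of_nonneg_left h2 (Nat.cast_nonneg n)).trans h1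
  rw [mul_one_div, div_le_iff₀ (by positivity)] at h4
  linarith

theorem bellRatio_sub_one_mul_log_le {n : ℕ} (hn : 1 ≤ n) :
    (bellRatio n - 1) * Real.log (bellRatio n) ≤ n := by
  have h := bellRatio_mul_one_sub_inv_pow_le hn
  have hm1 := one_lt_bellRatio hn
  have hm := bellRatio_pos n
  set m := bellRatio n
  have hy : 0 < 1 - 1 / m := by
    rw [sub_pos, div_lt_one hm]; exact hm1
  have h1 := Real.log_nonpos (by positivity) h
  rw [Real.log_mul hm.ne' (by positivity), Real.log_pow] at h1
  have h2 := Real.one_sub_inv_le_log_of_pos hy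
  have hm' : m - 1 ≠ 0 := by linarith
  have h3 : 1 - (1 - 1 / m)⁻¹ = -(1 / (m - 1)) := by
    rw [show 1 - 1 / m = (m - 1) / m by field_simp]; field_simp; ring
  rw [h3] at h2
  have h4 := mul_le_mul_of_nonneg_left h2 (Nat.cast_nonneg (α := ℝ) n)
  have h5 : Real.log m ≤ n * (1 / (m - 1)) := by linarith
  rw [mul_one_div, le_div_iff₀ (by linarith)] at h5
  linarith

/-- A crude bound `m ≥ c * n ^ (2/3)`, from `log m ≤ 2 * √m`. It suffices for the error terms: any
exponent above `1/2` makes `n ^ 4 / m ^ 4` smaller than `n ^ 2` by a power of `n`. -/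
theorem sq_le_mul_bellRatio_pow {n : ℕ} (hn : 1 ≤ n) : (n : ℝ) ^ 2 ≤ 16 * bellRatio n ^ 3 := by
  have h := le_bellRatio_add_one_mul_log hn
  have hm1 := one_lt_bellRatio hn
  set m := bellRatio n
  have hm : 0 ≤ m := by linarith
  have h1 : Real.log m ≤ 2 * √m := by
    have := Real.log_le_sub_one_of_pos (Real.sqrt_pos.mpr (show 0 < m by linarith))
    rw [Real.log_sqrt hm] at this
    linarith
  have h2 : (n : ℝ) ≤ 4 * m * √m := by
    have h3 := mul_le_mul_of_nonneg_left h1 (show 0 ≤ m + 1 by linarith)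
    have := Real.sqrt_nonneg m
    nlinarith
  calc (n : ℝ) ^ 2 ≤ (4 * m * √m) ^ 2 := pow_le_pow_left₀ (Nat.cast_nonneg n) h2 2
    _ = 16 * m ^ 2 * (√m) ^ 2 := by ring
    _ = 16 * m ^ 3 := by rw [Real.sq_sqrt hm]; ring

theorem rpow_le_bellRatio_sub {n i : ℕ} (hn : 8 ≤ n) (hi : i ≤ 4) :
    (n : ℝ) ^ (2 / 3 : ℝ) / 4 ≤ bellRatio (n - i) := by
  have h := sq_le_mul_bellRatio_pow (show 1 ≤ n - i by omega)
  have hm := bellRatio_pos (n - i)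
  have hle : (n : ℝ) / 2 ≤ (n - i : ℕ) := by
    rw [div_le_iff₀ (by norm_num)]
    exact_mod_cast (by omega : n ≤ (n - i) * 2)
  refine le_of_pow_le_pow_left₀ (n := 3) (by norm_num) hm.le ?_
  have e : ((n : ℝ) ^ (2 / 3 : ℝ)) ^ 3 = (n : ℝ) ^ 2 := by
    rw [← Real.rpow_natCast, ← Real.rpow_mul (Nat.cast_nonneg n)]
    norm_num
  rw [div_pow, e]
  have := pow_le_pow_left₀ (by positivity) hle 2
  rw [div_pow] at this
  linarith

theorem tendsto_bellRatio : Tendsto bellRatio atTop atTop := by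
  have h : Tendsto (fun n : ℕ => (n : ℝ) ^ (2 / 3 : ℝ) / 4) atTop atTop :=
    ((tendsto_rpow_atTop (by norm_num)).comp tendsto_natCast_atTop_atTop).atTop_div_const
      (by norm_num)
  refine tendsto_atTop_mono' _ ?_ h
  filter_upwards [eventually_ge_atTop 8] with n hn
  exact rpow_le_bellRatio_sub (i := 0) hn (by norm_num)

/-- The precise growth of the ratio of consecutive Bell numbers. -/
theorem tendsto_bellRatio_log :
    Tendsto (fun n : ℕ => (Real.log n * bellRatio n / n - 1) * Real.log n / Real.log (Real.log n))
      atTop (𝓝 1) := by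
  have hmt := tendsto_bellRatio
  have hlt : Tendsto (fun n => Real.log (bellRatio n)) atTop atTop :=
    Real.tendsto_log_atTop.comp hmt
  have hllt : Tendsto (fun n => Real.log (Real.log (bellRatio n))) atTop atTop :=
    Real.tendsto_log_atTop.comp hlt
  have hlog_div : Tendsto (fun x : ℝ => Real.log x / x) atTop (𝓝 0) := by
    simpa using Real.tendsto_pow_log_div_mul_add_atTop 1 0 1 one_ne_zero
  set m := bellRatio with hm_def
  -- Writing `n = θ * m * log m` gives `log n = log m + log log m + log θ`. Since `|θ - 1| ≤ 1/m`,
  -- even `(1 - θ) * log m` tends to `0`, so `log log m` alone governs the second-order term.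
  set θ : ℕ → ℝ := fun n => n / (m n * Real.log (m n)) with hθ
  have hθd : ∀ᶠ n in atTop, |θ n - 1| ≤ 1 / m n := by
    filter_upwards [eventually_ge_atTop 1, hlt.eventually_gt_atTop 0] with n hn hl
    have hm := bellRatio_pos n
    have h1 := le_bellRatio_add_one_mul_log hn
    have h2 := bellRatio_sub_one_mul_log_le hn
    rw [← hm_def] at *
    rw [abs_le]
    constructor
    · rw [hθ, neg_le_sub_iff_le_add]
      simp only
      rw [← sub_le_iff_le_add, le_div_iff₀ (by positivity)]
      have : (1 - 1 / m n) * (m n * Real.log (m n)) = (m n - 1) * Real.log (m n) := by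
        field_simp
      linarith
    · rw [hθ, sub_le_iff_le_add]
      simp only
      rw [div_le_iff₀ (by positivity)]
      have : (1 / m n + 1) * (m n * Real.log (m n)) = (m n + 1) * Real.log (m n) := by
        field_simp; ring
      linarith
  have hinv : Tendsto (fun n => 1 / m n) atTop (𝓝 0) := by
    simpa [Function.comp_def] using tendsto_inv_atTop_zero.comp hmt
  have hθ1 : Tendsto θ atTop (𝓝 1) := by
    rw [tendsto_iff_norm_sub_tendsto_zero]
    exact squeeze_zero' (Eventually.of_forall fun _ => norm_nonneg _) hθd hinv
  have hθl : Tendsto (fun n => (1 - θ n) * Real.log (m n)) atTop (𝓝 0) := by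
    refine squeeze_zero_norm' ?_ (hlog_div.comp hmt)
    filter_upwards [hθd, hlt.eventually_gt_atTop 0] with n h1 hl
    rw [norm_mul, Real.norm_eq_abs, Real.norm_eq_abs, abs_of_pos hl, abs_sub_comm]
    calc _ ≤ 1 / m n * Real.log (m n) := mul_le_mul_of_nonneg_right h1 hl.le
      _ = _ := by simp only [Function.comp]; ring
  have hlθ : Tendsto (fun n => Real.log (θ n)) atTop (𝓝 0) := by
    simpa [Function.comp_def] using (Real.continuousAt_log one_ne_zero).tendsto.comp hθ1
  have hlogn : ∀ᶠ n : ℕ in atTop, Real.log n =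
      Real.log (m n) + Real.log (Real.log (m n)) + Real.log (θ n) := by
    filter_upwards [eventually_ge_atTop 1, hlt.eventually_gt_atTop 0] with n hn hl
    have hm : 0 < m n := bellRatio_pos n
    have hn' : (0 : ℝ) < n := by exact_mod_cast hn
    simp only [hθ]
    rw [Real.log_div hn'.ne' (by positivity), Real.log_mul hm.ne' hl.ne']
    ring
  have hLl : Tendsto (fun n : ℕ => Real.log n / Real.log (m n)) atTop (𝓝 1) := by
    have h1 : Tendsto (fun n : ℕ => 1 + Real.log (Real.log (m n)) / Real.log (m n) +
        Real.log (θ n) * (Real.log (m n))⁻¹) atTop (𝓝 (1 + 0 + 0 * 0)) :=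
      (tendsto_const_nhds.add (hlog_div.comp hlt)).add (hlθ.mul hlt.inv_tendsto_atTop)
    simp only [add_zero, mul_zero] at h1
    refine h1.congr' ?_
    filter_upwards [hlogn, hlt.eventually_gt_atTop 0] with n h hl
    rw [h]
    field_simp
  have hloglog : ∀ᶠ n : ℕ in atTop, Real.log (Real.log n) =
      Real.log (Real.log (m n)) + Real.log (Real.log n / Real.log (m n)) := by
    filter_upwards [hlt.eventually_gt_atTop 0, (Real.tendsto_log_atTop.comp
      tendsto_natCast_atTop_atTop).eventually_gt_atTop 0] with n hl hL
    simp only [Function.comp] at hL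
    rw [Real.log_div hL.ne' hl.ne']
    ring
  have hℓ : Tendsto (fun n : ℕ => Real.log (Real.log n) / Real.log (Real.log (m n)))
      atTop (𝓝 1) := by
    have h1 : Tendsto (fun n : ℕ => 1 + Real.log (Real.log n / Real.log (m n)) *
        (Real.log (Real.log (m n)))⁻¹) atTop (𝓝 (1 + Real.log 1 * 0)) :=
      tendsto_const_nhds.add (((Real.continuousAt_log one_ne_zero).tendsto.comp hLl).mul
        hllt.inv_tendsto_atTop)
    simp only [mul_zero, add_zero] at h1
    refine h1.congr' ?_
    filter_upwards [hloglog, hllt.eventually_gt_atTop 0] with n h hl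
    rw [h]
    field_simp
  have hnum : Tendsto (fun n : ℕ => 1 + (Real.log (θ n) + (1 - θ n) * Real.log (m n)) *
      (Real.log (Real.log (m n)))⁻¹) atTop (𝓝 (1 + (0 + 0) * 0)) :=
    tendsto_const_nhds.add ((hlθ.add hθl).mul hllt.inv_tendsto_atTop)
  simp only [mul_zero, add_zero] at hnum
  have hall := ((hnum.mul hLl).div hθ1 one_ne_zero).div hℓ one_ne_zero
  simp only [mul_one, div_one] at hall
  refine hall.congr' ?_
  filter_upwards [hlogn, hllt.eventually_gt_atTop 0, hlt.eventually_gt_atTop 0,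
    eventually_ge_atTop 1, (Real.tendsto_log_atTop.comp (Real.tendsto_log_atTop.comp
      tendsto_natCast_atTop_atTop)).eventually_gt_atTop 0] with n h hll hl hn hLL
  simp only [Function.comp] at hLL
  have hm : 0 < m n := bellRatio_pos n
  have hn' : (0 : ℝ) < n := by exact_mod_cast hn
  have hθ0 : θ n ≠ 0 := by simp only [hθ]; positivity
  have e : Real.log n * m n / n - 1 =
      (Real.log (Real.log (m n)) + Real.log (θ n) + (1 - θ n) * Real.log (m n)) /
        (θ n * Real.log (m n)) := by
    have : Real.log n * m n / n = Real.log n / (θ n * Real.log (m n)) := by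
      simp only [hθ]; field_simp
    rw [this, h]
    field_simp
    ring
  rw [e]
  simp only [Pi.div_apply]
  field_simp
  ring

/-! ### Asymptotics of the mean over all partitions. -/

theorem bell_div_bell_succ (n : ℕ) :
    (Nat.bell n : ℝ) / Nat.bell (n + 1) = (bellRatio n)⁻¹ := by
  rw [bellRatio, inv_div]

theorem bell_div_bell_trans (a b c : ℕ) :
    (Nat.bell a : ℝ) / Nat.bell c = Nat.bell a / Nat.bell b * (Nat.bell b / Nat.bell c) := by
  have := bell_pos b
  field_simp

theorem cast_choose_four_le (n : ℕ) : (n.choose 4 : ℝ) ≤ (n : ℝ) ^ 4 / 24 := by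
  have := Nat.choose_le_pow_div (α := ℝ) 4 n
  simpa [Nat.factorial] using this

theorem abs_meanCro_sub_le {n : ℕ} (hn : 8 ≤ n) :
    |meanCro n - n / 2 * bellRatio n| ≤ 40 * ((n : ℝ) ^ 2 / (n : ℝ) ^ (2 / 3 : ℝ)) := by
  have hn8 : (8 : ℝ) ≤ n := by exact_mod_cast hn
  have b1 := rpow_le_bellRatio_sub (i := 1) hn (by norm_num)
  have b2 := rpow_le_bellRatio_sub (i := 2) hn (by norm_num)
  have b3 := rpow_le_bellRatio_sub (i := 3) hn (by norm_num)
  have b4 := rpow_le_bellRatio_sub (i := 4) hn (by norm_num)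
  have ht1 : 1 ≤ (n : ℝ) ^ (2 / 3 : ℝ) := Real.one_le_rpow (by linarith) (by norm_num)
  have htn : (n : ℝ) ^ (2 / 3 : ℝ) ≤ n := by
    conv_rhs => rw [← Real.rpow_one (n : ℝ)]
    exact Real.rpow_le_rpow_of_exponent_le (by linarith) (by norm_num)
  have ht3 : ((n : ℝ) ^ (2 / 3 : ℝ)) ^ 3 = (n : ℝ) ^ 2 := by
    rw [← Real.rpow_natCast, ← Real.rpow_mul (Nat.cast_nonneg n)]
    norm_num
  set t := (n : ℝ) ^ (2 / 3 : ℝ)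
  have ht : 0 < t := by linarith
  have inv_le : ∀ {x : ℝ}, t / 4 ≤ x → 0 ≤ x⁻¹ ∧ x⁻¹ ≤ 4 / t := by
    intro x hx
    have h4 : 0 < t / 4 := by positivity
    refine ⟨inv_nonneg.mpr (h4.le.trans hx), ?_⟩
    have := inv_anti₀ h4 hx
    rwa [inv_div] at this
  obtain ⟨p1, u1⟩ := inv_le b1
  obtain ⟨p2, u2⟩ := inv_le b2
  obtain ⟨p3, u3⟩ := inv_le b3
  obtain ⟨p4, u4⟩ := inv_le b4
  have r1 : (bellB ((n : ℤ) - 1) : ℝ) / bellB n = (bellRatio (n - 1))⁻¹ := by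
    rw [show (n : ℤ) - 1 = (n - 1 : ℕ) by omega, bellB_natCast, bellB_natCast,
      ← bell_div_bell_succ, show n - 1 + 1 = n by omega]
  have r2 : (bellB ((n : ℤ) - 2) : ℝ) / bellB n =
      (bellRatio (n - 2))⁻¹ * (bellRatio (n - 1))⁻¹ := by
    rw [show (n : ℤ) - 2 = (n - 2 : ℕ) by omega, bellB_natCast, bellB_natCast,
      ← bell_div_bell_succ, ← bell_div_bell_succ, show n - 2 + 1 = n - 1 by omega,
      show n - 1 + 1 = n by omega, ← bell_div_bell_trans]
  have r4 : (bellB ((n : ℤ) - 4) : ℝ) / bellB n =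
      (bellRatio (n - 4))⁻¹ * (bellRatio (n - 3))⁻¹ * (bellRatio (n - 2))⁻¹ *
        (bellRatio (n - 1))⁻¹ := by
    rw [show (n : ℤ) - 4 = (n - 4 : ℕ) by omega, bellB_natCast, bellB_natCast,
      ← bell_div_bell_succ, ← bell_div_bell_succ, ← bell_div_bell_succ, ← bell_div_bell_succ,
      show n - 4 + 1 = n - 3 by omega, show n - 3 + 1 = n - 2 by omega,
      show n - 2 + 1 = n - 1 by omega,
      show n - 1 + 1 = n by omega, ← bell_div_bell_trans, ← bell_div_bell_trans,
      ← bell_div_bell_trans]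
  have r0 : (bellB (n + 1) : ℝ) / bellB n = bellRatio n := by
    rw [show (n : ℤ) + 1 = (n + 1 : ℕ) by push_cast; ring, bellB_natCast, bellB_natCast, bellRatio]
  rw [meanCro_eq, r0, r1, r2, r4]
  set T := (n : ℝ) ^ 2 / t
  have hT0 : 0 ≤ T := by positivity
  have h0 : 3 * (n : ℝ) / 2 ≤ 3 / 2 * T := by
    have : (n : ℝ) ≤ T := by
      rw [le_div_iff₀ ht]; nlinarith
    linarith
  have h1 : (n : ℝ) * (4 * n + 1) / 2 * (bellRatio (n - 1))⁻¹ ≤ 10 * T := by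
    calc _ ≤ (5 / 2 * (n : ℝ) ^ 2) * (4 / t) :=
          mul_le_mul (by nlinarith) u1 p1 (by positivity)
      _ = 10 * T := by simp only [T]; field_simp; norm_num
  have h1' : 0 ≤ (n : ℝ) * (4 * n + 1) / 2 * (bellRatio (n - 1))⁻¹ := by positivity
  have h2 : 2 * (n.choose 2 : ℝ) * ((bellRatio (n - 2))⁻¹ * (bellRatio (n - 1))⁻¹) ≤ 16 * T := by
    have hc : 2 * (n.choose 2 : ℝ) ≤ (n : ℝ) ^ 2 := by
      rw [Nat.cast_choose_two]; nlinarith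
    calc _ ≤ (n : ℝ) ^ 2 * ((4 / t) * (4 / t)) :=
          mul_le_mul hc (mul_le_mul u2 u1 p1 (by positivity)) (by positivity) (by positivity)
      _ = 16 * T * (1 / t) := by simp only [T]; field_simp; norm_num
      _ ≤ 16 * T * 1 := mul_le_mul_of_nonneg_left ((div_le_one ht).mpr ht1) (by positivity)
      _ = 16 * T := mul_one _
  have h2' : 0 ≤ 2 * (n.choose 2 : ℝ) * ((bellRatio (n - 2))⁻¹ * (bellRatio (n - 1))⁻¹) := by
    positivity
  have h4 : (n.choose 4 : ℝ) * ((bellRatio (n - 4))⁻¹ * (bellRatio (n - 3))⁻¹ *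
      (bellRatio (n - 2))⁻¹ * (bellRatio (n - 1))⁻¹) ≤ 11 * T := by
    calc _ ≤ (n : ℝ) ^ 4 / 24 * ((4 / t) * (4 / t) * (4 / t) * (4 / t)) := by
          refine mul_le_mul (cast_choose_four_le n) ?_ (by positivity) (by positivity)
          gcongr
      _ = 256 / 24 * ((n : ℝ) ^ 2 * (n : ℝ) ^ 2 / (t ^ 3 * t)) := by field_simp; norm_num
      -- As `t ^ 3 = n ^ 2`, the bound on the `n ^ 4` term has the same order as `T`.
      _ = 256 / 24 * T := by rw [ht3]; simp only [T]; field_simp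
      _ ≤ 11 * T := by linarith
  have h4' : 0 ≤ (n.choose 4 : ℝ) * ((bellRatio (n - 4))⁻¹ * (bellRatio (n - 3))⁻¹ *
      (bellRatio (n - 2))⁻¹ * (bellRatio (n - 1))⁻¹) := by positivity
  rw [abs_le]
  constructor <;> linarith

theorem tendsto_log_sq_div_rpow :
    Tendsto (fun n : ℕ => (Real.log n) ^ 2 / (n : ℝ) ^ (2 / 3 : ℝ)) atTop (𝓝 0) := by
  have h := (isLittleO_log_rpow_rpow_atTop 2 (show (0 : ℝ) < 2 / 3 by norm_num)).tendsto_div_nhds_zero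
  simpa [Function.comp_def] using h.comp tendsto_natCast_atTop_atTop

theorem meanCro_asymptotic : ∃ ε : ℕ → ℝ, Tendsto ε atTop (𝓝 0) ∧
    ∀ᶠ n : ℕ in atTop, meanCro n =
      (n : ℝ) ^ 2 / (2 * Real.log n) *
        (1 + Real.log (Real.log n) / Real.log n * (1 + ε n)) := by
  have hL : Tendsto (fun n : ℕ => Real.log n) atTop atTop :=
    Real.tendsto_log_atTop.comp tendsto_natCast_atTop_atTop
  have hℓ : Tendsto (fun n : ℕ => Real.log (Real.log n)) atTop atTop :=
    Real.tendsto_log_atTop.comp hL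
  -- The witness is the claimed expansion solved for `ε n`.
  refine ⟨fun n => (2 * Real.log n * meanCro n / (n : ℝ) ^ 2 - 1) * Real.log n /
    Real.log (Real.log n) - 1, ?_, ?_⟩
  · have herr : Tendsto (fun n : ℕ => 2 * (meanCro n - n / 2 * bellRatio n) / (n : ℝ) ^ 2 *
        (Real.log n) ^ 2 / Real.log (Real.log n)) atTop (𝓝 0) := by
      have h80 := tendsto_log_sq_div_rpow.const_mul 80
      rw [mul_zero] at h80
      refine squeeze_zero_norm' ?_ h80
      filter_upwards [eventually_ge_atTop 8, hℓ.eventually_ge_atTop 1] with n hn hl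
      have hn0 : (0 : ℝ) < n := by exact_mod_cast (by omega : 0 < n)
      have ht : 0 < (n : ℝ) ^ (2 / 3 : ℝ) := Real.rpow_pos_of_pos hn0 _
      have h := abs_meanCro_sub_le hn
      rw [Real.norm_eq_abs, abs_div, abs_mul, abs_div, abs_mul, abs_two,
        abs_of_pos (pow_pos hn0 2), abs_of_nonneg (sq_nonneg (Real.log n)),
        abs_of_pos (by linarith : 0 < Real.log (Real.log n))]
      refine (div_le_self (by positivity) hl).trans ?_
      calc _ ≤ 2 * (40 * ((n : ℝ) ^ 2 / (n : ℝ) ^ (2 / 3 : ℝ))) / (n : ℝ) ^ 2 *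
            (Real.log n) ^ 2 := by gcongr
        _ = _ := by field_simp; ring
    have hsum := (tendsto_bellRatio_log.add herr).sub_const 1
    simp only [add_zero, sub_self] at hsum
    refine hsum.congr' ?_
    filter_upwards [eventually_ge_atTop 8] with n hn
    have hn0 : (n : ℝ) ≠ 0 := by exact_mod_cast (by omega : n ≠ 0)
    rw [← add_div]
    congr 2
    field_simp
    ring
  · filter_upwards [eventually_ge_atTop 8, hℓ.eventually_ge_atTop 1, hL.eventually_ge_atTop 1]
      with n hn hl hl'
    have hn0 : (n : ℝ) ≠ 0 := by exact_mod_cast (by omega : n ≠ 0)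
    have h1 : Real.log n ≠ 0 := by linarith
    have h2 : Real.log (Real.log n) ≠ 0 := by linarith
    field_simp
    ring

/-! ### Asymptotics for a fixed number of blocks. -/

theorem stirlingSecond_le_pow (n k : ℕ) : (Nat.stirlingSecond n k : ℝ) ≤ (k : ℝ) ^ n := by
  rw [← sum_descFactorial_stirlingSecond (show n < n + k + 1 by omega) k]
  refine le_trans ?_ (single_le_sum (f := fun j => (k.descFactorial j : ℝ) * n.stirlingSecond j)
    (fun j _ => by positivity) (mem_range.mpr (show k < n + k + 1 by omega)))
  rw [Nat.descFactorial_self]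
  exact le_mul_of_one_le_left (Nat.cast_nonneg _) (by exact_mod_cast k.factorial_pos)

theorem pow_le_stirlingSecond {n k : ℕ} (hkn : k ≤ n) :
    k ^ (n - k) ≤ Nat.stirlingSecond n k := by
  induction hkn with
  | refl => simp [Nat.stirlingSecond_self]
  | @step n hkn ih =>
    rcases k with _ | k
    · simp
    have hkn' : k + 1 ≤ n := hkn
    rw [Nat.stirlingSecond_succ_succ, show n + 1 - (k + 1) = n - (k + 1) + 1 by omega, pow_succ']
    exact (Nat.mul_le_mul_left _ ih).trans (Nat.le_add_right _ _)

theorem tendsto_pow_mul_stirlingS_div {k : ℕ} (hk : 1 ≤ k) (a b j : ℕ) (hb : 1 ≤ b) :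
    Tendsto (fun n : ℕ => (n : ℝ) ^ j *
      ((stirlingS ((n : ℤ) - a) ((k : ℤ) - b) : ℝ) / (stirlingS n k : ℝ))) atTop (𝓝 0) := by
  have hk0 : (0 : ℝ) < k := by exact_mod_cast hk
  -- Any ratio in `[(k - 1) / k, 1)` would dominate; this one stays positive at `k = 1`, which the
  -- division by `r ^ a` requires.
  set r : ℝ := k / (k + 1) with hr
  have hr0 : 0 < r := by positivity
  have hr1 : r < 1 := by rw [hr, div_lt_one (by positivity)]; linarith
  have hlim := (tendsto_pow_const_mul_const_pow_of_abs_lt_one j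
    (show |r| < 1 by rwa [abs_of_pos hr0])).const_mul ((k : ℝ) ^ k / r ^ a)
  rw [mul_zero] at hlim
  refine squeeze_zero' (Eventually.of_forall fun n => by positivity) ?_ hlim
  filter_upwards [eventually_ge_atTop (k + a)] with n hn
  have hnum : (stirlingS ((n : ℤ) - a) ((k : ℤ) - b) : ℝ) ≤ (k * r) ^ (n - a) := by
    rcases lt_or_ge k b with h | h
    · rw [stirlingS, if_neg (by omega), Nat.cast_zero]
      positivity
    · rw [show (n : ℤ) - a = (n - a : ℕ) by omega, show (k : ℤ) - b = (k - b : ℕ) by omega,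
        stirlingS_natCast]
      refine (stirlingSecond_le_pow _ _).trans (pow_le_pow_left₀ (Nat.cast_nonneg _) ?_ _)
      have h1 : ((k - b : ℕ) : ℝ) ≤ k - 1 := by
        rw [Nat.cast_sub h]
        have : (1 : ℝ) ≤ b := by exact_mod_cast hb
        linarith
      refine h1.trans ?_
      rw [hr, ← mul_div_assoc, le_div_iff₀ (by positivity)]
      nlinarith
  have hden : (k : ℝ) ^ (n - k) ≤ (stirlingS n k : ℝ) := by
    rw [stirlingS_natCast]
    exact_mod_cast pow_le_stirlingSecond (show k ≤ n by omega)
  have hden0 : (0 : ℝ) < (k : ℝ) ^ (n - k) := by positivity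
  have hratio : (stirlingS ((n : ℤ) - a) ((k : ℤ) - b) : ℝ) / (stirlingS n k : ℝ) ≤
      (k : ℝ) ^ k / r ^ a * r ^ n := by
    refine (div_le_div₀ (by positivity) hnum hden0 hden).trans ?_
    rw [div_le_iff₀ hden0, mul_pow]
    have e1 : (k : ℝ) ^ k * (k : ℝ) ^ (n - k) = (k : ℝ) ^ n := by
      rw [← pow_add]; congr 1; omega
    have e2 : r ^ n = r ^ (n - a) * r ^ a := by
      rw [← pow_add]; congr 1; omega
    have e3 : (k : ℝ) ^ k / r ^ a * r ^ n * (k : ℝ) ^ (n - k) = (k : ℝ) ^ n * r ^ (n - a) := by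
      rw [e2, ← e1]; field_simp
    rw [e3]
    refine mul_le_mul_of_nonneg_right ?_ (by positivity)
    exact pow_le_pow_right₀ (by exact_mod_cast hk) (Nat.sub_le n a)
  calc _ ≤ (n : ℝ) ^ j * ((k : ℝ) ^ k / r ^ a * r ^ n) :=
        mul_le_mul_of_nonneg_left hratio (by positivity)
    _ = _ := by ring

theorem meanCroBlocks_tendsto {k : ℕ} (hk : 1 ≤ k) :
    Tendsto (fun n : ℕ => meanCroBlocks n k - 1 / 2 * (n : ℝ) * ((k : ℝ) - 1)) atTop (𝓝 0) := by
  have t1 := tendsto_pow_mul_stirlingS_div hk 1 1 1 le_rfl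
  have t2 := tendsto_pow_mul_stirlingS_div hk 1 1 2 le_rfl
  have t3 := tendsto_pow_mul_stirlingS_div hk 2 2 1 one_le_two
  have t4 := tendsto_pow_mul_stirlingS_div hk 2 2 2 one_le_two
  have t5 := tendsto_pow_mul_stirlingS_div hk 4 2 4 one_le_two
  have t6 : Tendsto (fun n : ℕ => (n.choose 4 : ℝ) *
      ((stirlingS ((n : ℤ) - (4 : ℕ)) ((k : ℤ) - (2 : ℕ)) : ℝ) / (stirlingS n k : ℝ)))
      atTop (𝓝 0) := by
    refine squeeze_zero (fun n => by positivity) (fun n => ?_) t5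
    refine mul_le_mul_of_nonneg_right ((cast_choose_four_le n).trans ?_) (by positivity)
    have : (0 : ℝ) ≤ (n : ℝ) ^ 4 := by positivity
    linarith
  -- The polynomial coefficients are split into monomials: `-n (4n - 5k + 1) / 2 = -2 n ^ 2 - n (1 -
  -- 5k) / 2` and `2 * n.choose 2 = n ^ 2 - n`.
  have h := (((t2.const_mul (-2)).sub (t1.const_mul ((1 - 5 * (k : ℝ)) / 2))).sub
    (t4.sub t3)).add t6
  simp only [mul_zero, sub_zero, add_zero] at h
  refine h.congr' ?_
  filter_upwards [eventually_ge_atTop k] with n hn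
  rw [meanCroBlocks_eq hk hn, Nat.cast_choose_two]
  push_cast
  ring

theorem theorem2p4 :
    (∀ n : ℕ, meanCro n =
      (n : ℝ) / 2 * ((bellB (n + 1) : ℝ) / (bellB n : ℝ)) + 3 * (n : ℝ) / 2
        - (n : ℝ) * (4 * (n : ℝ) + 1) / 2 * ((bellB ((n : ℤ) - 1) : ℝ) / (bellB n : ℝ))
        - 2 * (n.choose 2 : ℝ) * ((bellB ((n : ℤ) - 2) : ℝ) / (bellB n : ℝ))
        + (n.choose 4 : ℝ) * ((bellB ((n : ℤ) - 4) : ℝ) / (bellB n : ℝ))) ∧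
    (∃ ε : ℕ → ℝ, Tendsto ε atTop (𝓝 0) ∧
      ∀ᶠ n : ℕ in atTop, meanCro n =
        (n : ℝ) ^ 2 / (2 * Real.log n) *
          (1 + Real.log (Real.log n) / Real.log n * (1 + ε n))) ∧
    (∀ n k : ℕ, 1 ≤ k → k ≤ n → meanCroBlocks n k =
      1 / 2 * (n : ℝ) * ((k : ℝ) - 1)
        - 1 / 2 * (n : ℝ) * (4 * (n : ℝ) - 5 * (k : ℝ) + 1) *
            ((stirlingS ((n : ℤ) - 1) ((k : ℤ) - 1) : ℝ) / (stirlingS n k : ℝ))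
        - 2 * (n.choose 2 : ℝ) *
            ((stirlingS ((n : ℤ) - 2) ((k : ℤ) - 2) : ℝ) / (stirlingS n k : ℝ))
        + (n.choose 4 : ℝ) *
            ((stirlingS ((n : ℤ) - 4) ((k : ℤ) - 2) : ℝ) / (stirlingS n k : ℝ))) ∧
    (∀ k : ℕ, 1 ≤ k →
      Tendsto (fun n : ℕ => meanCroBlocks n k - 1 / 2 * (n : ℝ) * ((k : ℝ) - 1)) atTop (𝓝 0)) := by
  exact ⟨meanCro_eq, meanCro_asymptotic, fun _ _ => meanCroBlocks_eq, fun _ => meanCroBlocks_tendsto⟩
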